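/- **Lemma 3.1.** *Standard pairs of pants.* For $c_1,c_2,c_3\ge 0$ let $\mathbf P(c_1,c_2,c_3)=\mathbb H^2/\Gamma(c_1,c_2,c_3)$, where $\Gamma(c_1,c_2,c_3)=\langle A_\infty,A_0,A_1\mid A_\infty A_0A_1=\mathrm{Id}\rangle$ is the subgroup of $\mathrm{PSL}(2,\mathbb R)$ generated by $$A_\infty=\begin{pmatrix}\cosh c_1&\cosh c_1+1\\ \cosh c_1-1&\cosh c_1\end{pmatrix},\qquad A_0=\begin{pmatrix}\cosh c_2&-\beta^{-1}\sinh^2c_2\\ -\beta&\cosh c_2\end{pmatrix},$$ $$\beta=\frac{\cosh c_1\cosh c_2+\cosh c_3+\sqrt{\cosh^2c_1+\cosh^2c_2+\cosh^2c_3+2\cosh c_1\cosh c_2\cosh c_3-1}}{\cosh c_1+1}$$ (so $\beta=\tanh\frac{c_1}2\coth\frac{\nu_1}2\sinh c_2$ with $\coth\nu_1=\frac{\cosh c_1\cosh c_2+\cosh c_3}{\sinh c_1\sinh c_2}$, $\nu_1>0$, if $c_1,c_2>0$). Its boundary components $\partial_\infty,\partial_0,\partial_1$ correspond to $A_\infty,A_0,A_1$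 and have lengths $2c_1,2c_2,2c_3$ (punctures for length $0$). The imaginary axis, the geodesic from $1$ to $\coth^2\frac{c_1}2$ (the line $\mathrm{Re}\,z=1$ if $c_1=0$) and the geodesic from $(\cosh c_2-1)/\beta$ to $(\cosh c_2+1)/\beta$ bound the white hexagon $\Delta_0(c_1,c_2,c_3)\subset\{z\in\mathbb H^2:\mathrm{Re}\, z\ge0\}$. Let $\Omega_\infty=\mathrm{Id}$. For an end with positive length let $\Omega_0$, respectively $\Omega_1$, be the orientation preserving isometry of $\mathbb H^2$ that takes $\Delta_0(c_1,c_2,c_3)$ to $\Delta_0(c_2,c_3,c_1)$, respectively $\Delta_0(c_3,c_1,c_2)$, and the axis of $A_0$, respectively $A_1$, to the axis of the new $A_\infty$. *The $\underline c$-gluing.* Let $\Sigma$ be a surface of finite type with a pants decomposition with pants curves $\sigma_1,\dots,\sigma_\xi$ and pairs of pants $P_1,\dots,P_k$, the boundary components of each $P_j$ being labelled $\partial_\infty,\partial_0,\partial_1$; each of them lies on a pants curve or is a puncture. Let $c_i>0$ and $\boldsymbol\mu_i\in\mathbb C$ with $0\le\mathrm{Im}\,\boldsymbol\mu_i<\pi$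 for $i=1,\dots,\xi$. Identify $P_j$ with the standard pair of pants whose boundary half-lengths are the $c_i$ of the pants curves and $0$ at punctures. For a boundary component $\partial_\varepsilon$ on $\sigma_i$ put $\kappa=\coth\frac{c_i}2$, let $$h^\theta_\varepsilon=\{z\in\mathbb H^2:\ |\Omega_\varepsilon(z)+i\kappa\tan\theta|=\kappa\sec\theta\},\qquad |\theta|<\tfrac\pi2,$$ be the hypercycles around the axis of $A_\varepsilon$, put $\theta_i=\frac12\mathrm{Im}\,\boldsymbol\mu_i$ and $h_\varepsilon=h_\varepsilon^{\theta_i}$, and let $H_\varepsilon$ be the union of the $h^\theta_\varepsilon$ with $|\theta-\theta_i|<\nu_i$, where $\nu_i>0$ and $\theta_i+\nu_i<\frac\pi2$. Let $S_j$ be the standard pair of pants with the projections of all $h^\theta_\varepsilon$, $\theta\le\theta_i-\nu_i$, removed. Assume that the $\nu_i$ are such that each strip $H_\varepsilon$ projects into $S_j$, to an embedded annulus $H_\varepsilon/\langle A_\varepsilon\rangle$, and that the annuli of different boundary components of $P_j$ are disjoint. Let $S(\underline c,\underline{\boldsymbol\mu})$ be the quotient of $S_1\sqcup\dots\sqcup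 S_k$ that identifies, for every $\sigma_i$ with sides $\partial_\varepsilon P_j$ and $\partial_{\varepsilon'}P_{j'}$, the projections of $z\in H_\varepsilon$ and $z'\in H_{\varepsilon'}$ whenever $$\Omega_{\varepsilon'}(z')=T_{\boldsymbol\mu_i}J\bigl(\Omega_\varepsilon(z)\bigr),\quad J=\begin{pmatrix}0&-\coth\frac{c_i}2\\ \tanh\frac{c_i}2&0\end{pmatrix},\quad T_{\boldsymbol\mu}=\begin{pmatrix}\cosh\frac{\boldsymbol\mu}2&-\sinh\frac{\boldsymbol\mu}2\coth\frac{c_i}2\\ -\sinh\frac{\boldsymbol\mu}2\tanh\frac{c_i}2&\cosh\frac{\boldsymbol\mu}2\end{pmatrix}.$$ The local inverses of the projections from $\mathbb H^2\subset\hat{\mathbb C}$ form the atlas of a complex projective structure on $S(\underline c,\underline{\boldsymbol\mu})$. Transport it to $\Sigma$ by a homeomorphism $f:\Sigma\to S(\underline c,\underline{\boldsymbol\mu})$ for which each $f(\sigma_i)$ is freely homotopic, as an unoriented curve, to the loop that is the projection of $h_\varepsilon$, and let $\rho_{\underline c,\underline{\boldsymbol\mu}}:\pi_1(\Sigma)\to\mathrm{PSL}(2,\mathbb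 C)$ be its holonomy representation (for which some developing map $\widetilde\Sigma\to\hat{\mathbb C}$ is equivariant; it is unique up to conjugation). *Claim.* If $\gamma\in\pi_1(\Sigma)$ is a loop freely homotopic to a pants curve $\sigma_i$, in either direction, then $\rho_{\underline c,\underline{\boldsymbol\mu}}(\gamma)$ is a hyperbolic element of $\mathrm{PSL}(2,\mathbb C)$, that is, conjugate to a dilation $z\mapsto r^2z$ with $r>1$ real, and its translation length in $\mathbb H^3$ is $2c_i$. -/

import Mathlib

open scoped MatrixGroups UpperHalfPlane Topology unitInterval ComplexOrder

noncomputable section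

namespace CGluing

/-! ### The groups `PSL(2, ℂ)`, hyperbolic elements and translation lengths -/

open Classical in
/-- `PSL(2, ℂ)` acts on the Riemann sphere `OnePoint ℂ = ℂℙ¹` by Möbius transformations. -/
instance : MulAction PSL(2, ℂ) (OnePoint ℂ) :=
  (OnePoint.equivProjectivization ℂ).mulAction PSL(2, ℂ)

/-- An element of `PSL(2, ℂ)` is hyperbolic if it is conjugate to a dilation `z ↦ r ^ 2 * z` with
`r > 1` real. (A loxodromic element with a rotational part is not hyperbolic.) -/
def IsHyperbolic (g : PSL(2, ℂ)) : Prop :=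
  ∃ (r : ℝ) (d : SL(2, ℂ)), 1 < r ∧ (d : Matrix (Fin 2) (Fin 2) ℂ) = !![(r : ℂ), 0; 0, (r : ℂ)⁻¹] ∧
    IsConj g (d : PSL(2, ℂ))

/-- Hyperbolic 3-space, as the symmetric space `SL(2, ℂ) / SU(2)` of positive definite Hermitian
matrices of determinant one. -/
def Hyp3 : Type :=
  {P : Matrix (Fin 2) (Fin 2) ℂ // P.PosDef ∧ P.det = 1}

/-- The hyperbolic distance (curvature `-1`): `cosh d(P, Q) = tr (P⁻¹ Q) / 2`. -/
def hypDist (P Q : Matrix (Fin 2) (Fin 2) ℂ) : ℝ :=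
  Real.arcosh ((P⁻¹ * Q).trace.re / 2)

/-- The translation length of an element of `PSL(2, ℂ)`: the infimum of the distances by which it
moves the points of hyperbolic 3-space, on which `a ∈ SL(2, ℂ)` acts by `P ↦ a P a*`. -/
def translationLength (g : PSL(2, ℂ)) : ℝ :=
  sInf {d : ℝ | ∃ (a : SL(2, ℂ)) (P : Hyp3), (a : PSL(2, ℂ)) = g ∧
    d = hypDist P.1 ((a : Matrix (Fin 2) (Fin 2) ℂ) * P.1 *
      (a : Matrix (Fin 2) (Fin 2) ℂ).conjTranspose)}

/-! ### Loops, developing maps and holonomy -/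

/-- Two based loops, with possibly different base points, are freely homotopic. -/
def FreelyHomotopic {X : Type*} [TopologicalSpace X] {x y : X} (γ : Path x x) (δ : Path y y) :
    Prop :=
  ∃ F : C(I × I, X), (∀ t, F (0, t) = γ t) ∧ (∀ t, F (1, t) = δ t) ∧ ∀ s, F (s, 0) = F (s, 1)

/-- Two loops are homotopic as unoriented closed curves. -/
def HomotopicCurves {X : Type*} [TopologicalSpace X] {x y : X} (γ : Path x x) (δ : Path y y) :
    Prop :=
  FreelyHomotopic γ δ ∨ FreelyHomotopic γ δ.symm

/-- The developing map `dev` and the holonomy representation `ρ` of the projective structure on `X`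
with atlas `𝒜`. Here `p : E → X` is the universal covering and `e₀` a base point of `E`.
The map `dev` is near each point a projective chart, that is, a chart of the atlas followed by an
element of `PSL(2, ℂ)`, and it is `ρ`-equivariant, where the class of a loop `γ` at `p e₀` acts on
`E` by the deck transformation that takes `e₀` to the end point of the lift of `γ` from `e₀`.
In Mathlib's fundamental group `a * b` runs through `b` first; the opposite group is the
fundamental group with `a * b` running through `a` first, for which `ρ` is a homomorphism. -/
structure IsDevelopingPair {X E : Type*} [TopologicalSpace X] [TopologicalSpace E]
    (𝒜 : Set (OpenPartialHomeomorph X (OnePoint ℂ))) (p : E → X) (e₀ : E)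
    (dev : E → OnePoint ℂ) (ρ : (FundamentalGroup X (p e₀))ᵐᵒᵖ →* PSL(2, ℂ)) : Prop where
  chart : ∀ y : E, ∃ φ ∈ 𝒜, p y ∈ φ.source ∧
    ∃ g : PSL(2, ℂ), ∀ᶠ y' in 𝓝 y, dev y' = g • φ (p y')
  equivariant : ∀ (τ : E ≃ₜ E), (∀ y, p (τ y) = p y) →
    ∀ (γ : Path (p e₀) (p e₀)) (γlift : Path e₀ (τ e₀)), (∀ t, p (γlift t) = γ t) →
      ∀ y, dev (τ y) =
        ρ (MulOpposite.op (FundamentalGroup.fromPath (Path.Homotopic.Quotient.mk γ))) • dev y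

/-! ### The standard pair of pants -/

/-- The labels of the three boundary components of a pair of pants. -/
inductive PantsEnd
  | infty
  | zero
  | one

/-- The polynomial `C₁² + C₂² + C₃² + 2 C₁ C₂ C₃ - 1` in `C_k = cosh c_k`, where `c₁, c₂, c₃` are
the half-lengths `ℓ ∞, ℓ 0, ℓ 1` of the boundary components. -/
def disc (ℓ : PantsEnd → ℝ) : ℝ :=
  Real.cosh (ℓ .infty) ^ 2 + Real.cosh (ℓ .zero) ^ 2 + Real.cosh (ℓ .one) ^ 2
    + 2 * Real.cosh (ℓ .infty) * Real.cosh (ℓ .zero) * Real.cosh (ℓ .one) - 1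

/-- The number `tanh (c₁/2) * coth (ν₁/2) * sinh c₂`, where `ν₁ > 0` is given by
`coth ν₁ = (cosh c₁ cosh c₂ + cosh c₃) / (sinh c₁ sinh c₂)`, written in a form that extends
continuously to vanishing `c₁, c₂, c₃` (see `beta_eq`). -/
def beta (ℓ : PantsEnd → ℝ) : ℝ :=
  (Real.cosh (ℓ .infty) * Real.cosh (ℓ .zero) + Real.cosh (ℓ .one) + √(disc ℓ)) /
    (Real.cosh (ℓ .infty) + 1)

theorem beta_pos (ℓ : PantsEnd → ℝ) : 0 < beta ℓ := by
  unfold beta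
  have h1 := Real.cosh_pos (ℓ .infty)
  have h2 := Real.cosh_pos (ℓ .zero)
  have h3 := Real.cosh_pos (ℓ .one)
  positivity

/-- The matrix `A_∞` of the boundary component `∂_∞`: hyperbolic with translation length `2 c₁` if
`c₁ > 0`, and parabolic if `c₁ = 0`. -/
def Ainfty (ℓ : PantsEnd → ℝ) : SL(2, ℝ) :=
  ⟨!![Real.cosh (ℓ .infty), Real.cosh (ℓ .infty) + 1;
      Real.cosh (ℓ .infty) - 1, Real.cosh (ℓ .infty)], by
    rw [Matrix.det_fin_two_of]; ring⟩

/-- The matrix `A_0` of the boundary component `∂_0`. -/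
def Azero (ℓ : PantsEnd → ℝ) : SL(2, ℝ) :=
  ⟨!![Real.cosh (ℓ .zero), -(Real.sinh (ℓ .zero) ^ 2 / beta ℓ);
      -beta ℓ, Real.cosh (ℓ .zero)], by
    rw [Matrix.det_fin_two_of]
    have h := (beta_pos ℓ).ne'
    have h2 := Real.cosh_sq (ℓ .zero)
    field_simp
    linarith⟩

/-- The matrices `A_∞`, `A_0`, `A_1`, with `A_∞ A_0 A_1 = 1`. -/
def A (ℓ : PantsEnd → ℝ) : PantsEnd → SL(2, ℝ)
  | .infty => Ainfty ℓ
  | .zero => Azero ℓ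
  | .one => (Ainfty ℓ * Azero ℓ)⁻¹

/-- The Fuchsian group `Γ(c₁, c₂, c₃)`; the standard pair of pants is `ℍ / Γ(c₁, c₂, c₃)`. -/
def pantsGroup (ℓ : PantsEnd → ℝ) : Subgroup SL(2, ℝ) :=
  Subgroup.closure (Set.range (A ℓ))

/-- The value of `beta` through the number `ν₁` when the lengths do not vanish: the off-diagonal
entries of `A_0` are then `-coth (c₁/2) tanh (ν₁/2) sinh c₂` and
`-tanh (c₁/2) coth (ν₁/2) sinh c₂`. -/
theorem beta_eq (ℓ : PantsEnd → ℝ) (h1 : 0 < ℓ .infty) (h2 : 0 < ℓ .zero) (ν₁ : ℝ) (hν : 0 < ν₁)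
    (h : (Real.tanh ν₁)⁻¹ =
      (Real.cosh (ℓ .infty) * Real.cosh (ℓ .zero) + Real.cosh (ℓ .one)) /
        (Real.sinh (ℓ .infty) * Real.sinh (ℓ .zero))) :
    Real.tanh (ℓ .infty / 2) * (Real.tanh (ν₁ / 2))⁻¹ * Real.sinh (ℓ .zero) = beta ℓ := by
  have hS1 := Real.sinh_pos_iff.2 h1
  have hS2 := Real.sinh_pos_iff.2 h2
  have hC1 := Real.cosh_pos (ℓ .infty)
  have hs := Real.sinh_pos_iff.2 (half_pos hν)
  have hk := Real.cosh_pos (ν₁ / 2)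
  have hcs := Real.cosh_sq (ν₁ / 2)
  have e1 : Real.sinh ν₁ = 2 * Real.sinh (ν₁ / 2) * Real.cosh (ν₁ / 2) := by
    rw [← Real.sinh_two_mul]; congr 1; ring
  have e2 : Real.cosh ν₁ = Real.cosh (ν₁ / 2) ^ 2 + Real.sinh (ν₁ / 2) ^ 2 := by
    rw [← Real.cosh_two_mul]; congr 1; ring
  have t1 : Real.tanh (ℓ .infty / 2) = Real.sinh (ℓ .infty) / (Real.cosh (ℓ .infty) + 1) := by
    have a1 : Real.sinh (ℓ .infty) =
        2 * Real.sinh (ℓ .infty / 2) * Real.cosh (ℓ .infty / 2) := by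
      rw [← Real.sinh_two_mul]; congr 1; ring
    have a2 : Real.cosh (ℓ .infty) + 1 = 2 * Real.cosh (ℓ .infty / 2) ^ 2 := by
      have a3 : Real.cosh (ℓ .infty) =
          Real.cosh (ℓ .infty / 2) ^ 2 + Real.sinh (ℓ .infty / 2) ^ 2 := by
        rw [← Real.cosh_two_mul]; congr 1; ring
      have := Real.cosh_sq (ℓ .infty / 2)
      linarith
    have := Real.cosh_pos (ℓ .infty / 2)
    rw [a1, a2, Real.tanh_eq_sinh_div_cosh]
    field_simp
  rw [Real.tanh_eq_sinh_div_cosh, inv_div, e1, e2] at h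
  set N := Real.cosh (ℓ .infty) * Real.cosh (ℓ .zero) + Real.cosh (ℓ .one) with hN
  set P := Real.sinh (ℓ .infty) * Real.sinh (ℓ .zero) with hP
  have hPpos : 0 < P := mul_pos hS1 hS2
  set s := Real.sinh (ν₁ / 2)
  set k := Real.cosh (ν₁ / 2)
  have hN' : N = P * (k ^ 2 + s ^ 2) / (2 * s * k) := by
    field_simp at h ⊢
    linarith
  have hD : disc ℓ = N ^ 2 - P ^ 2 := by
    have q1 := Real.cosh_sq (ℓ .infty)
    have q2 := Real.cosh_sq (ℓ .zero)
    rw [hP, mul_pow, show Real.sinh (ℓ .infty) ^ 2 = Real.cosh (ℓ .infty) ^ 2 - 1 by linarith,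
      show Real.sinh (ℓ .zero) ^ 2 = Real.cosh (ℓ .zero) ^ 2 - 1 by linarith, hN, disc]
    ring
  have hsq : √(disc ℓ) = P / (2 * s * k) := by
    rw [show disc ℓ = (P / (2 * s * k)) ^ 2 by
      rw [hD, hN', hcs]
      field_simp
      rw [show k ^ 2 = s ^ 2 + 1 from hcs]
      ring, Real.sqrt_sq (by positivity)]
  rw [t1, Real.tanh_eq_sinh_div_cosh, inv_div, beta, ← hN, hsq, hN', hcs]
  rw [show Real.sinh (ℓ .infty) / (Real.cosh (ℓ .infty) + 1) * (k / s) * Real.sinh (ℓ .zero) =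
    P * k / (s * (Real.cosh (ℓ .infty) + 1)) by rw [hP]; field_simp]
  field_simp
  rw [show k ^ 2 = s ^ 2 + 1 from hcs]
  ring

/-- The Möbius transformation of a matrix, at a finite point. -/
def moeb (M : Matrix (Fin 2) (Fin 2) ℂ) (z : ℂ) : ℂ :=
  (M 0 0 * z + M 0 1) / (M 1 0 * z + M 1 1)

/-- The right end point on the real line of the common perpendicular of the axes of `A_0` and
`A_1`. This seam is `|z - cosh c₂ / β| = 1 / β`. The other two seams are the imaginary
axis, between the axes of `A_∞` and `A_0`, and the geodesic from `1` to `coth² (c₁/2)`, between the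
axes of `A_1` and `A_∞`. The three seams bound the white hexagon in `Re z ≥ 0`. -/
def seamRight (ℓ : PantsEnd → ℝ) : ℝ := (Real.cosh (ℓ .zero) + 1) / beta ℓ

/-- The left end point on the real line of the common perpendicular of the axes of `A_0` and `A_1`. -/
def seamLeft (ℓ : PantsEnd → ℝ) : ℝ := (Real.cosh (ℓ .zero) - 1) / beta ℓ

/-- A matrix of the Möbius transformation `Ω_ε` that takes the white hexagon of the standard pair
of pants to the white hexagon of the standard pair of pants with cyclically permuted labels,
and the axis of `A_ε` to the axis of the new `A_∞`: the labels of the new pair of pants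
are `(ℓ 0, ℓ 1, ℓ ∞)` for `ε = 0` and `(ℓ 1, ℓ ∞, ℓ 0)` for `ε = 1`.
On the end points of the seams, `Ω_0` takes `seamRight` to `0`, `seamLeft` to `∞`, `0` to
`coth² (ℓ 0 / 2)` and `∞` to `1`, while `Ω_1` takes `1` to `∞`, `coth² (ℓ ∞ / 2)` to `0`, `seamLeft`
to `1` and `seamRight` to `coth² (ℓ 1 / 2)`. -/
def Omega (ℓ : PantsEnd → ℝ) : PantsEnd → Matrix (Fin 2) (Fin 2) ℝ
  | .infty => 1
  | .zero => !![1, -seamRight ℓ; 1, -seamLeft ℓ]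
  | .one =>
    !![-((1 - seamLeft ℓ) * (Real.cosh (ℓ .infty) - 1)),
        (1 - seamLeft ℓ) * (Real.cosh (ℓ .infty) + 1);
      -((Real.cosh (ℓ .infty) + 1) - (Real.cosh (ℓ .infty) - 1) * seamLeft ℓ),
        (Real.cosh (ℓ .infty) + 1) - (Real.cosh (ℓ .infty) - 1) * seamLeft ℓ]

/-- The coordinate `Ω_ε z` of a point `z` of the upper half-plane. -/
def endCoord (ℓ : PantsEnd → ℝ) (ε : PantsEnd) (z : ℍ) : ℂ :=
  moeb ((Omega ℓ ε).map (algebraMap ℝ ℂ)) z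

/-! ### Hypercycles and strips -/

/-- The point `w` of the upper half-plane lies on the hypercycle with parameter `θ` around the
geodesic from `-coth (c/2)` to `coth (c/2)`. Positive `θ` are below the geodesic, where the rest of
the pair of pants is; the infinite area end is above. -/
def OnHypercycle (c θ : ℝ) (w : ℂ) : Prop :=
  θ ∈ Set.Ioo (-(Real.pi / 2)) (Real.pi / 2) ∧
    ‖w + Complex.I * ((Real.tanh (c / 2))⁻¹ * Real.tan θ : ℝ)‖ =
      (Real.tanh (c / 2))⁻¹ / Real.cos θ

/-- The hypercycle `h_ε` in the upper half-plane, with `θ = Im μ / 2`. -/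
def hypercycle (ℓ : PantsEnd → ℝ) (ε : PantsEnd) (μ : ℂ) : Set ℍ :=
  {z | OnHypercycle (ℓ ε) (μ.im / 2) (endCoord ℓ ε z)}

/-- The strip `H_ε` around the hypercycle `h_ε`, made up of the hypercycles whose parameter differs
from `Im μ / 2` by less than `ν`. -/
def strip (ℓ : PantsEnd → ℝ) (ε : PantsEnd) (μ : ℂ) (ν : ℝ) : Set ℍ :=
  {z | ∃ θ, |θ - μ.im / 2| < ν ∧ OnHypercycle (ℓ ε) θ (endCoord ℓ ε z)}

/-- The closed region behind the outer boundary of the strip `H_ε`. -/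
def outside (ℓ : PantsEnd → ℝ) (ε : PantsEnd) (μ : ℂ) (ν : ℝ) : Set ℍ :=
  {z | ∃ θ, θ ≤ μ.im / 2 - ν ∧ OnHypercycle (ℓ ε) θ (endCoord ℓ ε z)}

/-- The matrix `J` of the rotation by `π` about `i coth (c/2)`. -/
def J (c : ℝ) : Matrix (Fin 2) (Fin 2) ℂ :=
  !![0, -((Real.tanh (c / 2))⁻¹ : ℝ); (Real.tanh (c / 2) : ℝ), 0]

/-- The matrix `T_μ` of the complex translation along the geodesic from `-coth (c/2)` to
`coth (c/2)`. -/
def T (c : ℝ) (μ : ℂ) : Matrix (Fin 2) (Fin 2) ℂ :=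
  !![Complex.cosh (μ / 2), -Complex.sinh (μ / 2) * ((Real.tanh (c / 2))⁻¹ : ℝ);
    -Complex.sinh (μ / 2) * (Real.tanh (c / 2) : ℝ), Complex.cosh (μ / 2)]

/-! ### The gluing -/

/-- The combinatorial data of a pants decomposition: every boundary component of every pair of
pants lies on a pants curve or is a puncture (`none`), and every pants curve has two sides. -/
structure PantsDecomposition where
  numPants : ℕ
  numCurves : ℕ
  label : Fin numPants × PantsEnd → Option (Fin numCurves)
  two_sides : ∀ i, {s | label s = some i}.ncard = 2

namespace PantsDecomposition

variable (D : PantsDecomposition) (c : Fin D.numCurves → ℝ) (μ : Fin D.numCurves → ℂ)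
  (ν : Fin D.numCurves → ℝ)

/-- The half-lengths of the boundary components of the `j`-th pair of pants: `c i` on the `i`-th
pants curve and `0` at a puncture. -/
def halfLength (j : Fin D.numPants) (ε : PantsEnd) : ℝ :=
  (D.label (j, ε)).elim 0 c

/-- The group of the `j`-th pair of pants. -/
def group (j : Fin D.numPants) : Subgroup SL(2, ℝ) :=
  pantsGroup (D.halfLength c j)

/-- The preimage in the upper half-plane of the truncated pair of pants `S_j`: what lies behind the
outer boundaries of the annuli around the boundary components is removed. -/
def truncated (j : Fin D.numPants) : Set ℍ :=
  {z | ∀ ε i, D.label (j, ε) = some i →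
    ∀ g ∈ D.group c j, g • z ∉ outside (D.halfLength c j) ε (μ i) (ν i)}

/-- The standing assumption of the construction: the strips project to embedded annuli in the
truncated pairs of pants, and the annuli of different boundary components of a pair of pants are
disjoint. -/
structure Admissible : Prop where
  width_pos : ∀ i, 0 < ν i
  width_lt : ∀ i, (μ i).im / 2 + ν i < Real.pi / 2
  annulus : ∀ j ε i, D.label (j, ε) = some i → ∀ g ∈ D.group c j,
    ∀ z ∈ strip (D.halfLength c j) ε (μ i) (ν i),
      g • z ∈ strip (D.halfLength c j) ε (μ i) (ν i) →
        g ∈ Subgroup.zpowers (A (D.halfLength c j) ε)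
  disjoint : ∀ j ε ε' i i', ε ≠ ε' → D.label (j, ε) = some i → D.label (j, ε') = some i' →
    ∀ g ∈ D.group c j, ∀ z ∈ strip (D.halfLength c j) ε (μ i) (ν i),
      g • z ∉ strip (D.halfLength c j) ε' (μ i') (ν i')
  subset_truncated : ∀ j ε i, D.label (j, ε) = some i →
    strip (D.halfLength c j) ε (μ i) (ν i) ⊆ D.truncated c μ ν j

/-- The disjoint union of the preimages of the truncated pairs of pants. -/
abbrev Cover : Type := Σ j : Fin D.numPants, D.truncated c μ ν j

/-- The identifications on the disjoint union: by the group of each pair of pants, and across each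
pants curve by `Ω_ε' z' = T_μ J (Ω_ε z)` on the strips. (As `(T_μ J)² = -1`, the last condition is
symmetric in the two sides.) -/
inductive Rel : D.Cover c μ ν → D.Cover c μ ν → Prop
  | deck (j : Fin D.numPants) (g : SL(2, ℝ)) (hg : g ∈ D.group c j)
      (z z' : D.truncated c μ ν j) (h : (z' : ℍ) = g • (z : ℍ)) : Rel ⟨j, z⟩ ⟨j, z'⟩
  | glue (i : Fin D.numCurves) (j j' : Fin D.numPants) (ε ε' : PantsEnd)
      (hne : (j, ε) ≠ (j', ε')) (hj : D.label (j, ε) = some i) (hj' : D.label (j', ε') = some i)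
      (z : D.truncated c μ ν j) (z' : D.truncated c μ ν j')
      (hz : (z : ℍ) ∈ strip (D.halfLength c j) ε (μ i) (ν i))
      (hz' : (z' : ℍ) ∈ strip (D.halfLength c j') ε' (μ i) (ν i))
      (h : endCoord (D.halfLength c j') ε' z' =
        moeb (T (c i) (μ i) * J (c i)) (endCoord (D.halfLength c j) ε z)) :
      Rel ⟨j, z⟩ ⟨j', z'⟩

/-- The glued surface `S(c, μ)`, with the quotient topology. -/
def Surface : Type := Quot (D.Rel c μ ν)

instance : TopologicalSpace (D.Surface c μ ν) :=
  inferInstanceAs (TopologicalSpace (Quot (D.Rel c μ ν)))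

/-- The projection to the glued surface. -/
def proj (j : Fin D.numPants) (z : D.truncated c μ ν j) : D.Surface c μ ν :=
  Quot.mk _ ⟨j, z⟩

/-- The charts of the projective structure of the glued surface: the local inverses of the
projections of the truncated pieces of the upper half-plane. -/
def charts : Set (OpenPartialHomeomorph (D.Surface c μ ν) (OnePoint ℂ)) :=
  {φ | ∃ j, ∀ x ∈ φ.source, ∃ z : D.truncated c μ ν j,
    D.proj c μ ν j z = x ∧ φ x = (((z : ℍ) : ℂ) : OnePoint ℂ)}

/-- The loop `δ` runs once around the annulus of the `i`-th pants curve: it is the projection of a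
path on the hypercycle `h_ε`, on one side of the curve, from a point `z` to `A_ε z`. -/
def IsCoreLoop (i : Fin D.numCurves) {x : D.Surface c μ ν} (δ : Path x x) : Prop :=
  ∃ (j : Fin D.numPants) (ε : PantsEnd) (ζ : C(I, D.truncated c μ ν j)),
    D.label (j, ε) = some i ∧
    (∀ t, (ζ t : ℍ) ∈ hypercycle (D.halfLength c j) ε (μ i)) ∧
    (ζ 1 : ℍ) = A (D.halfLength c j) ε • (ζ 0 : ℍ) ∧
    ∀ t, δ t = D.proj c μ ν j (ζ t)

end PantsDecomposition

end CGluing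

end

noncomputable section

namespace CGluing

/-! ### Möbius transformations as a relation -/

/-! The core loop of the annulus of `σ_i` can be read off in one half-plane, on one side of the
curve: it is the image of a path on `h_ε` from `z` to `A_ε z`. Near each point of this path the
developing map is `G` composed with a local inverse of the projection, for a unique `G` in `PSL(2,
ℂ)`. Uniqueness makes `G` locally constant along the path, hence constant. If the deck
transformation `τ` translates along the loop and acts on values by `h`, comparing germs at the two
ends gives `h * G = G * A_ε` (`isConj_of_translates`). So `h` is conjugate to the real matrix `A_ε`,
which `Ω_ε` conjugates up to sign to the standard translation with eigenvalues `exp (± c_i)`. The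
gluing parameter `μ_i` does not enter the conjugacy class.

The main work is the existence of `G`. A chart of the atlas may invert the projection of any
translate of the strip, or of the strip on the other side of `σ_i`. `TwoSides.Reach` lists
everything identified with a point of a strip: its orbit, and the orbits of the points glued to its
translates. That no longer chains occur rests on the annuli being embedded and disjoint, and on the
gluing map being an involution that turns `A_ε` into the inverse of `A_ε'`. As powers of `A_ε` act
discretely on the strip, the projection is injective near its points, and every chart there is a
Möbius transformation of `z` (`TwoSides.chart_eq`).

A free homotopy from `γ` to the core loop lifts to the universal covering, so the deck
transformation of `γ`, or its inverse, translates along a lift of the core loop; a dilation is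
conjugate to its inverse, so orientation is harmless. The translation length of a dilation comes
from an explicit trace estimate on positive definite matrices. -/

/-- The Möbius transformation of `M` takes the finite point `z` to the finite point `w`. -/
def Mob (M : Matrix (Fin 2) (Fin 2) ℂ) (z w : ℂ) : Prop :=
  M 1 0 * z + M 1 1 ≠ 0 ∧ M 0 0 * z + M 0 1 = w * (M 1 0 * z + M 1 1)

theorem Mob.comp {M N : Matrix (Fin 2) (Fin 2) ℂ} {z w v : ℂ} (h : Mob N w v) (h' : Mob M z w) :
    Mob (N * M) z v := by
  obtain ⟨h1, h2⟩ := h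
  obtain ⟨h3, h4⟩ := h'
  have e : (N * M) 1 0 * z + (N * M) 1 1 = (N 1 0 * w + N 1 1) * (M 1 0 * z + M 1 1) := by
    simp only [Matrix.mul_apply, Fin.sum_univ_two]
    linear_combination N 1 0 * h4
  refine ⟨e ▸ mul_ne_zero h1 h3, ?_⟩
  rw [e]
  simp only [Matrix.mul_apply, Fin.sum_univ_two]
  linear_combination N 0 0 * h4 + (M 1 0 * z + M 1 1) * h2

theorem Mob.unique {M : Matrix (Fin 2) (Fin 2) ℂ} {z w v : ℂ} (h : Mob M z w) (h' : Mob M z v) :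
    w = v :=
  mul_right_cancel₀ h.1 (h.2.symm.trans h'.2)

theorem mob_smul_iff {M : Matrix (Fin 2) (Fin 2) ℂ} {k : ℂ} (hk : k ≠ 0) {z w : ℂ} :
    Mob (k • M) z w ↔ Mob M z w := by
  simp only [Mob, Matrix.smul_apply, smul_eq_mul]
  rw [show k * M 1 0 * z + k * M 1 1 = k * (M 1 0 * z + M 1 1) by ring,
    show k * M 0 0 * z + k * M 0 1 = k * (M 0 0 * z + M 0 1) by ring, mul_left_comm w k]
  simp [hk]

theorem mob_neg_iff {M : Matrix (Fin 2) (Fin 2) ℂ} {z w : ℂ} : Mob (-M) z w ↔ Mob M z w := by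
  rw [← neg_one_smul ℂ M]
  exact mob_smul_iff (by norm_num)

theorem Mob.adjugate {M : Matrix (Fin 2) (Fin 2) ℂ} (hM : M.det ≠ 0) {z w : ℂ} (h : Mob M z w) :
    Mob M.adjugate w z := by
  obtain ⟨h1, h2⟩ := h
  rw [Matrix.det_fin_two] at hM
  simp only [Mob, Matrix.adjugate_fin_two, Matrix.of_apply, Matrix.cons_val', Matrix.cons_val_zero,
    Matrix.cons_val_one, Matrix.cons_val_fin_one]
  refine ⟨fun h0 => hM ?_, ?_⟩
  · linear_combination (M 1 0 * z + M 1 1) * h0 - M 1 0 * h2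
  · linear_combination -h2

theorem Mob.of_comp {M N : Matrix (Fin 2) (Fin 2) ℂ} (hN : N.det ≠ 0) {z w v : ℂ}
    (h : Mob (N * M) z v) (h' : Mob N w v) : Mob M z w := by
  have := (h'.adjugate hN).comp h
  rwa [← mul_assoc, Matrix.adjugate_mul, smul_mul_assoc, one_mul, mob_smul_iff hN] at this

/-- A vanishing denominator gives `moeb` the default value `0`. Points of the upper half-plane are
never `0`, so for them an equation with `moeb` already says that the denominator does not vanish. -/
theorem mob_moeb {M : Matrix (Fin 2) (Fin 2) ℂ} {z w : ℂ} (hw : w ≠ 0) (h : w = moeb M z) :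
    Mob M z w := by
  have h0 : M 1 0 * z + M 1 1 ≠ 0 := by
    rintro h0
    rw [moeb, h0, div_zero] at h
    exact hw h
  refine ⟨h0, ?_⟩
  rw [h, moeb, div_mul_cancel₀ _ h0]

theorem Mob.eq_moeb {M : Matrix (Fin 2) (Fin 2) ℂ} {z w : ℂ} (h : Mob M z w) : w = moeb M z := by
  rw [moeb, h.2, mul_div_cancel_right₀ _ h.1]

/-- The complexification of a real matrix. -/
abbrev cplx (M : Matrix (Fin 2) (Fin 2) ℝ) : Matrix (Fin 2) (Fin 2) ℂ := M.map (algebraMap ℝ ℂ)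

theorem cplx_mul (M N : Matrix (Fin 2) (Fin 2) ℝ) : cplx (M * N) = cplx M * cplx N :=
  Matrix.map_mul

theorem cplx_neg (M : Matrix (Fin 2) (Fin 2) ℝ) : cplx (-M) = -cplx M := by
  ext i j; simp [cplx]

theorem det_cplx (M : Matrix (Fin 2) (Fin 2) ℝ) : (cplx M).det = (M.det : ℂ) := by
  simp [Matrix.det_fin_two, cplx]

theorem mob_smul (g : SL(2, ℝ)) (z : ℍ) :
    Mob (cplx (g : Matrix (Fin 2) (Fin 2) ℝ)) z (g • z : ℍ) := by
  have h := UpperHalfPlane.coe_specialLinearGroup_apply g z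
  refine mob_moeb (UpperHalfPlane.ne_zero _) ?_
  rw [h]
  simp [moeb, cplx]

/-! ### The action of `PSL(2, ℂ)` on the Riemann sphere -/

theorem psl_smul {a : SL(2, ℂ)} {z w : ℂ} (h : Mob (a : Matrix (Fin 2) (Fin 2) ℂ) z w) :
    (a : PSL(2, ℂ)) • (z : OnePoint ℂ) = (w : OnePoint ℂ) := by
  classical
  have hv : (a : Matrix (Fin 2) (Fin 2) ℂ).mulVec ![z, 1] ≠ 0 := by
    intro h0
    have := congrFun h0 1
    simp at this
    exact h.1 this
  have e : (a : PSL(2, ℂ)) • (z : OnePoint ℂ) = (OnePoint.equivProjectivization ℂ).symm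
      (Projectivization.mk ℂ ((a : Matrix (Fin 2) (Fin 2) ℂ).mulVec ![z, 1]) hv) := by
    convert! rfl
  rw [e, OnePoint.equivProjectivization_symm_apply_mk]
  have h2 := h.2
  have h1 := h.1
  rw [if_neg (by simpa using h.1)]
  congr 1
  simp only [Matrix.mulVec_fin_two, Matrix.cons_val_zero, Matrix.cons_val_one, mul_one]
  rw [h2]
  field_simp

/-- Dividing by a square root of the determinant moves the matrix into `SL(2, ℂ)` without changing
the transformation. -/
theorem exists_psl {M : Matrix (Fin 2) (Fin 2) ℂ} (hM : M.det ≠ 0) :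
    ∃ g : PSL(2, ℂ), ∀ z w : ℂ, Mob M z w → g • (z : OnePoint ℂ) = (w : OnePoint ℂ) := by
  obtain ⟨s, hs⟩ := IsAlgClosed.exists_pow_nat_eq M.det (n := 2) (by norm_num)
  have hs0 : s ≠ 0 := by
    rintro rfl
    exact hM (by rw [← hs]; norm_num)
  let a : SL(2, ℂ) := ⟨s⁻¹ • M, by rw [Matrix.det_smul, ← hs]; simp [hs0]⟩
  exact ⟨(a : PSL(2, ℂ)), fun z w h => psl_smul ((mob_smul_iff (inv_ne_zero hs0)).2 h)⟩

/-- An element of `PSL(2, ℂ)` that fixes infinitely many points is trivial. -/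
theorem psl_eq_one_of_fix {g : PSL(2, ℂ)} {s : Set ℂ} (hs : s.Infinite)
    (h : ∀ z ∈ s, g • (z : OnePoint ℂ) = (z : OnePoint ℂ)) : g = 1 := by
  classical
  induction g using QuotientGroup.induction_on with | H a =>
  -- Fixed points are roots of this polynomial of degree at most two. If the denominator vanishes,
  -- `z` is sent to infinity and is not fixed.
  have hq : ∀ z ∈ s, a 1 0 * z ^ 2 + (a 1 1 - a 0 0) * z - a 0 1 = 0 := by
    intro z hz
    by_cases hd : a 1 0 * z + a 1 1 = 0
    · exfalso
      have hn : a 0 0 * z + a 0 1 ≠ 0 := by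
        intro hn
        have := a.det_coe
        rw [Matrix.det_fin_two] at this
        have h1 : (a 0 0 * a 1 1 - a 0 1 * a 1 0) = 0 := by linear_combination a 0 0 * hd - a 1 0 * hn
        rw [h1] at this
        exact zero_ne_one this
      have hv : (a : Matrix (Fin 2) (Fin 2) ℂ).mulVec ![z, 1] ≠ 0 := by
        intro h0
        have := congrFun h0 0
        simp at this
        exact hn this
      have e : (a : PSL(2, ℂ)) • (z : OnePoint ℂ) = (OnePoint.equivProjectivization ℂ).symm
          (Projectivization.mk ℂ ((a : Matrix (Fin 2) (Fin 2) ℂ).mulVec ![z, 1]) hv) := by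
        convert! rfl
      rw [h z hz, OnePoint.equivProjectivization_symm_apply_mk, if_pos (by simpa using hd)] at e
      exact OnePoint.coe_ne_infty z e
    · have := psl_smul (a := a) (z := z) (w := (a 0 0 * z + a 0 1) / (a 1 0 * z + a 1 1))
        ⟨hd, (div_mul_cancel₀ _ hd).symm⟩
      rw [h z hz, OnePoint.coe_eq_coe, eq_div_iff hd] at this
      linear_combination this
  let q : Polynomial ℂ := Polynomial.C (a 1 0) * Polynomial.X ^ 2 +
    Polynomial.C (a 1 1 - a 0 0) * Polynomial.X + Polynomial.C (-a 0 1)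
  have hq0 : q = 0 := by
    refine Polynomial.eq_zero_of_infinite_isRoot q (hs.mono fun z hz => ?_)
    have := hq z hz
    simp only [Set.mem_ofPred_eq, Polynomial.IsRoot, q]
    simp
    linear_combination this
  have c0 : a 0 1 = 0 := by
    have := congrArg (fun p => Polynomial.coeff p 0) hq0
    simpa [q, Polynomial.coeff_X] using this
  have c1 : a 1 1 = a 0 0 := by
    have := congrArg (fun p => Polynomial.coeff p 1) hq0
    simp [q, Polynomial.coeff_X_pow, Polynomial.coeff_C] at this
    linear_combination this
  have c2 : a 1 0 = 0 := by
    have := congrArg (fun p => Polynomial.coeff p 2) hq0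
    simpa [q, Polynomial.coeff_X, Polynomial.coeff_X_pow, Polynomial.coeff_C] using this
  rw [QuotientGroup.eq_one_iff, Matrix.SpecialLinearGroup.mem_center_iff]
  refine ⟨a 0 0, ?_, ?_⟩
  · have := a.det_coe
    rw [Matrix.det_fin_two, c0, c1] at this
    simp only [Fintype.card_fin]
    linear_combination this
  · ext i j
    fin_cases i <;> fin_cases j <;> simp [c0, c1, c2]

theorem infinite_coe_of_mem_nhds {U : Set ℍ} {z₀ : ℍ} (hU : U ∈ 𝓝 z₀) :
    ((↑) '' U : Set ℂ).Infinite := by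
  have := UpperHalfPlane.isOpenEmbedding_coe.image_mem_nhds.2 hU
  exact infinite_of_mem_nhds (z₀ : ℂ) this

theorem psl_eq_of_eventually {g g' : PSL(2, ℂ)} {z₀ : ℍ}
    (h : ∀ᶠ z : ℍ in 𝓝 z₀, g • ((z : ℂ) : OnePoint ℂ) = g' • ((z : ℂ) : OnePoint ℂ)) : g = g' := by
  have : g'⁻¹ * g = 1 := by
    refine psl_eq_one_of_fix (infinite_coe_of_mem_nhds h) ?_
    rintro _ ⟨z, hz, rfl⟩
    have hz' : g • ((z : ℂ) : OnePoint ℂ) = g' • ((z : ℂ) : OnePoint ℂ) := hz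
    rw [mul_smul, hz', inv_smul_smul]
  exact (inv_mul_eq_one.1 this).symm

/-! ### Translation lengths -/

/-- The diagonal matrix with entries `exp c` and `exp (-c)`. -/
def dilation (c : ℝ) : SL(2, ℂ) :=
  ⟨!![(Real.exp c : ℂ), 0; 0, (Real.exp c : ℂ)⁻¹], by
    rw [Matrix.det_fin_two_of]
    have : (Real.exp c : ℂ) ≠ 0 := by exact_mod_cast (Real.exp_pos c).ne'
    field_simp
    simp⟩

theorem coe_dilation (c : ℝ) : (dilation c : Matrix (Fin 2) (Fin 2) ℂ) =
    !![(Real.exp c : ℂ), 0; 0, (Real.exp c : ℂ)⁻¹] := rfl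

open Matrix in
theorem conjTranspose_dilation (c : ℝ) :
    (dilation c : Matrix (Fin 2) (Fin 2) ℂ)ᴴ = dilation c := by
  rw [coe_dilation, ← Complex.ofReal_inv]
  ext i j
  fin_cases i <;> fin_cases j <;> simp [-Complex.ofReal_exp, -Complex.ofReal_inv]

theorem cosh_two_mul_eq_exp (c : ℝ) :
    Real.cosh (2 * c) = (Real.exp c ^ 2 + (Real.exp c)⁻¹ ^ 2) / 2 := by
  rw [Real.cosh_eq, ← Real.exp_neg, ← Real.exp_nat_mul, ← Real.exp_nat_mul]
  norm_num

-- If `q` is the off-diagonal entry of `Q` and `r = exp c`, the trace is `r² + r⁻² + |q|² (r -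
-- r⁻¹)²`, because the product of the diagonal entries is `1 + |q|²`. Equality at `Q = 1` is
-- `trace_dilation_one`.
open Matrix in
theorem le_trace_dilation (c : ℝ) {Q : Matrix (Fin 2) (Fin 2) ℂ} (hQ : Q.IsHermitian)
    (hd : Q.det = 1) :
    Real.cosh (2 * c) ≤ (Q⁻¹ * ((dilation c : Matrix (Fin 2) (Fin 2) ℂ) * Q *
      (dilation c : Matrix (Fin 2) (Fin 2) ℂ)ᴴ)).trace.re / 2 := by
  have h00 : (Q 0 0).im = 0 := by
    have := congrArg Complex.im (hQ.apply 0 0)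
    simp at this
    linarith
  have h11 : (Q 1 1).im = 0 := by
    have := congrArg Complex.im (hQ.apply 1 1)
    simp at this
    linarith
  have h10 : Q 1 0 = star (Q 0 1) := (hQ.apply 1 0).symm
  have hr := congrArg Complex.re hd
  rw [det_fin_two, h10] at hr
  simp [h00, h11] at hr
  rw [Matrix.inv_def, hd, Ring.inverse_one, one_smul, adjugate_fin_two, conjTranspose_dilation,
    coe_dilation]
  have hp : Real.exp c * (Real.exp c)⁻¹ = 1 := mul_inv_cancel₀ (Real.exp_pos c).ne'
  rw [cosh_two_mul_eq_exp, ← Complex.ofReal_inv]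
  generalize Real.exp c = r at *
  generalize r⁻¹ = u at *
  rw [Q.eta_fin_two]
  simp [Matrix.trace_fin_two, h10, h00, h11]
  nlinarith [mul_nonneg (add_nonneg (mul_self_nonneg (Q 0 1).re) (mul_self_nonneg (Q 0 1).im))
    (mul_self_nonneg (r - u))]

open Matrix in
theorem trace_dilation_one (c : ℝ) :
    ((1 : Matrix (Fin 2) (Fin 2) ℂ)⁻¹ * ((dilation c : Matrix (Fin 2) (Fin 2) ℂ) * 1 *
      (dilation c : Matrix (Fin 2) (Fin 2) ℂ)ᴴ)).trace.re / 2 = Real.cosh (2 * c) := by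
  rw [cosh_two_mul_eq_exp, conjTranspose_dilation, coe_dilation, ← Complex.ofReal_inv]
  simp [Matrix.trace_fin_two, sq, -Complex.ofReal_exp, -Complex.ofReal_inv]

/-- The centre consists of the scalars with square `1`. The infimum in `translationLength` runs over
both lifts, and the displacement does not see the sign. -/
theorem coe_eq_or_neg {a b : SL(2, ℂ)} (h : (a : PSL(2, ℂ)) = b) :
    (b : Matrix (Fin 2) (Fin 2) ℂ) = a ∨ (b : Matrix (Fin 2) (Fin 2) ℂ) = -a := by
  rw [QuotientGroup.eq, Matrix.SpecialLinearGroup.mem_center_iff] at h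
  obtain ⟨r, hr, e⟩ := h
  have hb : (b : Matrix (Fin 2) (Fin 2) ℂ) = r • (a : Matrix (Fin 2) (Fin 2) ℂ) := by
    have : (b : Matrix (Fin 2) (Fin 2) ℂ) = a * (a⁻¹ * b : SL(2, ℂ)) := by
      rw [← Matrix.SpecialLinearGroup.coe_mul, mul_inv_cancel_left]
    rw [this, ← e]
    ext i j
    fin_cases i <;> fin_cases j <;> simp [Matrix.mul_apply, mul_comm]
  rw [Fintype.card_fin, sq_eq_one_iff] at hr
  rcases hr with rfl | rfl <;> simp [hb]

open Matrix in
/-- The displacement of `K D K⁻¹` at `P` is the displacement of `D` at `K⁻¹ P K⁻¹*`. -/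
theorem trace_conj {K Ki D P : Matrix (Fin 2) (Fin 2) ℂ} (h : K * Ki = 1) (hP : P.det = 1) :
    (P⁻¹ * ((K * D * Ki) * P * (K * D * Ki)ᴴ)).trace =
      ((Ki * P * Kiᴴ)⁻¹ * (D * (Ki * P * Kiᴴ) * Dᴴ)).trace := by
  have h' : Ki * K = 1 := mul_eq_one_comm.1 h
  have hs : Kiᴴ * Kᴴ = 1 := by rw [← conjTranspose_mul, h, conjTranspose_one]
  have hPu : P * P⁻¹ = 1 := mul_nonsing_inv _ (by rw [hP]; exact isUnit_one)
  have hQ : (Ki * P * Kiᴴ)⁻¹ = Kᴴ * P⁻¹ * K := by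
    refine inv_eq_right_inv ?_
    calc Ki * P * Kiᴴ * (Kᴴ * P⁻¹ * K) = Ki * P * (Kiᴴ * Kᴴ) * P⁻¹ * K := by
          simp only [mul_assoc]
      _ = Ki * (P * P⁻¹) * K := by rw [hs, mul_one]; simp only [mul_assoc]
      _ = 1 := by rw [hPu, mul_one, h']
  rw [hQ, conjTranspose_mul, conjTranspose_mul]
  rw [show Kᴴ * P⁻¹ * K * (D * (Ki * P * Kiᴴ) * Dᴴ) =
    Kᴴ * (P⁻¹ * K * (D * (Ki * P * Kiᴴ) * Dᴴ)) by simp only [mul_assoc], trace_mul_comm Kᴴ]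
  simp only [mul_assoc]

open Matrix in
theorem translationLength_of_isConj {g : PSL(2, ℂ)} {c : ℝ} (hc : 0 ≤ c)
    (h : IsConj g (dilation c : PSL(2, ℂ))) : translationLength g = 2 * c := by
  obtain ⟨k, hk⟩ := isConj_iff.1 h.symm
  induction k using QuotientGroup.induction_on with | H k =>
  subst hk
  set K : Matrix (Fin 2) (Fin 2) ℂ := (k : Matrix (Fin 2) (Fin 2) ℂ) with hKdef
  set Ki : Matrix (Fin 2) (Fin 2) ℂ := ((k⁻¹ : SL(2, ℂ)) : Matrix (Fin 2) (Fin 2) ℂ) with hKidef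
  have hKK : K * Ki = 1 := by
    rw [hKdef, hKidef, ← Matrix.SpecialLinearGroup.coe_mul, mul_inv_cancel]; rfl
  have hKK' : Ki * K = 1 := mul_eq_one_comm.1 hKK
  have hcosh : 1 ≤ Real.cosh (2 * c) := Real.one_le_cosh _
  -- The infimum is attained at `K * Kᴴ`, the image under `K` of the base point `1`, which lies on
  -- the axis of the dilation.
  refine IsLeast.csInf_eq ⟨⟨k * dilation c * k⁻¹, ⟨K * Kᴴ, ?_, ?_⟩, rfl, ?_⟩, ?_⟩
  · have := (Matrix.PosDef.one (n := Fin 2) (R := ℂ)).mul_mul_conjTranspose_same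
      (B := K) (Matrix.vecMul_injective_of_isUnit (IsUnit.of_mul_eq_one _ hKK))
    simpa using this
  · rw [det_mul, det_conjTranspose, hKdef, k.det_coe]; simp
  · have hdet : (K * Kᴴ).det = 1 := by rw [det_mul, det_conjTranspose, hKdef, k.det_coe]; simp
    have hone : Ki * (K * Kᴴ) * Kiᴴ = 1 := by
      rw [← mul_assoc, hKK', one_mul, ← conjTranspose_mul, hKK', conjTranspose_one]
    have e : ((k * dilation c * k⁻¹ : SL(2, ℂ)) : Matrix (Fin 2) (Fin 2) ℂ) =
      K * (dilation c : Matrix (Fin 2) (Fin 2) ℂ) * Ki := rfl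
    rw [hypDist, e, trace_conj hKK hdet, hone, trace_dilation_one, Real.arcosh_cosh (by positivity)]
  · rintro d ⟨a, P, ha, rfl⟩
    have e : P.1⁻¹ * ((a : Matrix (Fin 2) (Fin 2) ℂ) * P.1 * (a : Matrix (Fin 2) (Fin 2) ℂ)ᴴ) =
        P.1⁻¹ * ((K * (dilation c : Matrix (Fin 2) (Fin 2) ℂ) * Ki) * P.1 *
          (K * (dilation c : Matrix (Fin 2) (Fin 2) ℂ) * Ki)ᴴ) := by
      have ha' : ((k * dilation c * k⁻¹ : SL(2, ℂ)) : PSL(2, ℂ)) = a := ha.symm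
      rcases coe_eq_or_neg ha' with h | h <;> rw [h] <;> simp [K, Ki]
    have hQ : (Ki * P.1 * Kiᴴ).IsHermitian := isHermitian_mul_mul_conjTranspose _ P.2.1.isHermitian
    have hdet : (Ki * P.1 * Kiᴴ).det = 1 := by
      rw [det_mul, det_mul, det_conjTranspose, hKidef, (k⁻¹).det_coe, P.2.2]; simp
    have := le_trace_dilation c hQ hdet
    rw [hypDist, e, trace_conj hKK P.2.2]
    calc 2 * c = Real.arcosh (Real.cosh (2 * c)) := (Real.arcosh_cosh (by positivity)).symm
      _ ≤ _ := (Real.arcosh_le_arcosh (by linarith) (by linarith)).2 this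

theorem isHyperbolic_of_isConj {g : PSL(2, ℂ)} {c : ℝ} (hc : 0 < c)
    (h : IsConj g (dilation c : PSL(2, ℂ))) : IsHyperbolic g :=
  ⟨Real.exp c, dilation c, by simpa using hc, rfl, h⟩

theorem Mob.of_comp_right {M N : Matrix (Fin 2) (Fin 2) ℂ} (hM : M.det ≠ 0) {z w v : ℂ}
    (h : Mob (N * M) z v) (h' : Mob M z w) : Mob N w v := by
  have := h.comp (h'.adjugate hM)
  rwa [mul_assoc, Matrix.mul_adjugate, mul_smul_comm, mul_one, mob_smul_iff hM] at this

/-! ### The coordinates of the ends -/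

theorem cosh_le_sqrt_disc (ℓ : PantsEnd → ℝ) : Real.cosh (ℓ .zero) ≤ √(disc ℓ) := by
  have h1 := Real.one_le_cosh (ℓ .infty)
  have h2 := Real.one_le_cosh (ℓ .zero)
  have h3 := Real.one_le_cosh (ℓ .one)
  refine Real.le_sqrt_of_sq_le ?_
  have : 0 ≤ 2 * Real.cosh (ℓ .infty) * Real.cosh (ℓ .zero) * Real.cosh (ℓ .one) := by positivity
  unfold disc
  nlinarith

theorem seamLeft_lt_one (ℓ : PantsEnd → ℝ) : seamLeft ℓ < 1 := by
  have h1 := Real.one_le_cosh (ℓ .infty)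
  have h3 := Real.one_le_cosh (ℓ .one)
  have hd := cosh_le_sqrt_disc ℓ
  rw [seamLeft, div_lt_one (beta_pos ℓ), beta, lt_div_iff₀ (by positivity)]
  nlinarith

/-- `beta` is a root of this quadratic, whose discriminant is four times `disc`. Equivalently, `A_∞
A_0` has trace `-2 cosh c₃`, which is how the third length enters. -/
theorem beta_quadratic (ℓ : PantsEnd → ℝ) : (Real.cosh (ℓ .infty) + 1) * beta ℓ ^ 2 -
    2 * (Real.cosh (ℓ .infty) * Real.cosh (ℓ .zero) + Real.cosh (ℓ .one)) * beta ℓ +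
      (Real.cosh (ℓ .infty) - 1) * (Real.cosh (ℓ .zero) ^ 2 - 1) = 0 := by
  have h1 := Real.one_le_cosh (ℓ .infty)
  have h2 := Real.one_le_cosh (ℓ .zero)
  have h3 := Real.one_le_cosh (ℓ .one)
  have hp : 0 ≤ 2 * Real.cosh (ℓ .infty) * Real.cosh (ℓ .zero) * Real.cosh (ℓ .one) := by
    positivity
  have hd := Real.sq_sqrt (x := disc ℓ) (by unfold disc; nlinarith)
  have hb : beta ℓ * (Real.cosh (ℓ .infty) + 1) =
      Real.cosh (ℓ .infty) * Real.cosh (ℓ .zero) + Real.cosh (ℓ .one) + √(disc ℓ) := by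
    rw [beta, div_mul_cancel₀]
    positivity
  have h0 : Real.cosh (ℓ .infty) + 1 ≠ 0 := by positivity
  refine mul_right_cancel₀ h0 ?_
  rw [zero_mul]
  have hdd : disc ℓ = (Real.cosh (ℓ .infty) * Real.cosh (ℓ .zero) + Real.cosh (ℓ .one)) ^ 2 -
    (Real.cosh (ℓ .infty) ^ 2 - 1) * (Real.cosh (ℓ .zero) ^ 2 - 1) := by unfold disc; ring
  rw [hdd] at hd hb
  generalize √_ = r at *
  linear_combination hd + (beta ℓ * (Real.cosh (ℓ .infty) + 1) -
    (Real.cosh (ℓ .infty) * Real.cosh (ℓ .zero) + Real.cosh (ℓ .one)) + r) * hb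

/-- Positivity makes `Ω_ε` preserve the upper half-plane. For `Ω_1` the determinant is twice the
product of `1 - seamLeft ℓ` and the lower right entry, both positive since `seamLeft ℓ < 1`. -/
theorem det_Omega_pos (ℓ : PantsEnd → ℝ) (ε : PantsEnd) : 0 < (Omega ℓ ε).det := by
  have h1 := Real.one_le_cosh (ℓ .infty)
  have hs := seamLeft_lt_one ℓ
  cases ε with
  | infty => simp [Omega]
  | zero =>
    rw [Omega, Matrix.det_fin_two_of, seamLeft, seamRight]
    have := beta_pos ℓ
    have e : 1 * -((Real.cosh (ℓ .zero) - 1) / beta ℓ) - -((Real.cosh (ℓ .zero) + 1) / beta ℓ) * 1 =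
      2 / beta ℓ := by ring
    rw [e]
    positivity
  | one =>
    rw [Omega, Matrix.det_fin_two_of]
    have hb : 0 < (Real.cosh (ℓ .infty) + 1) - (Real.cosh (ℓ .infty) - 1) * seamLeft ℓ := by
      nlinarith
    have := mul_pos (sub_pos.2 hs) hb
    nlinarith

/-- The matrix of `Ω_ε` in `GL(2, ℝ)`. -/
def omegaGL (ℓ : PantsEnd → ℝ) (ε : PantsEnd) : GL (Fin 2) ℝ :=
  Matrix.GeneralLinearGroup.mkOfDetNeZero (Omega ℓ ε) (det_Omega_pos ℓ ε).ne.symm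

/-- The coordinate `Ω_ε z` as a point of the upper half-plane. -/
def endPt (ℓ : PantsEnd → ℝ) (ε : PantsEnd) (z : ℍ) : ℍ := omegaGL ℓ ε • z

theorem coe_endPt (ℓ : PantsEnd → ℝ) (ε : PantsEnd) (z : ℍ) :
    (endPt ℓ ε z : ℂ) = endCoord ℓ ε z := by
  rw [endPt, UpperHalfPlane.coe_smul_of_det_pos (g := omegaGL ℓ ε) (det_Omega_pos ℓ ε)]
  rfl

theorem endPt_injective (ℓ : PantsEnd → ℝ) (ε : PantsEnd) : Function.Injective (endPt ℓ ε) :=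
  MulAction.injective _

theorem continuous_endPt (ℓ : PantsEnd → ℝ) (ε : PantsEnd) : Continuous (endPt ℓ ε) :=
  continuous_const_smul _

theorem mob_endPt (ℓ : PantsEnd → ℝ) (ε : PantsEnd) (z : ℍ) :
    Mob (cplx (Omega ℓ ε)) z (endPt ℓ ε z) :=
  mob_moeb (UpperHalfPlane.ne_zero _) (coe_endPt ℓ ε z)

theorem det_cplx_Omega (ℓ : PantsEnd → ℝ) (ε : PantsEnd) : (cplx (Omega ℓ ε)).det ≠ 0 := by
  rw [det_cplx]
  exact_mod_cast (det_Omega_pos ℓ ε).ne.symm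

/-- The translation by `2 * c` along the geodesic from `-coth (c/2)` to `coth (c/2)`. -/
abbrev stdA (c : ℝ) : SL(2, ℝ) := Ainfty fun _ => c

theorem Omega_mul_A (ℓ : PantsEnd → ℝ) (ε : PantsEnd) :
    Omega ℓ ε * (A ℓ ε : Matrix (Fin 2) (Fin 2) ℝ) =
      (stdA (ℓ ε) : Matrix (Fin 2) (Fin 2) ℝ) * Omega ℓ ε ∨
    Omega ℓ ε * (A ℓ ε : Matrix (Fin 2) (Fin 2) ℝ) =
      -((stdA (ℓ ε) : Matrix (Fin 2) (Fin 2) ℝ) * Omega ℓ ε) := by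
  have hb := (beta_pos ℓ).ne'
  cases ε with
  | infty => left; simp [Omega, A, Ainfty]
  | zero =>
    left
    have hs := Real.sinh_sq (ℓ .zero)
    simp only [Omega, A, Ainfty, Azero, seamLeft, seamRight, hs]
    generalize Real.cosh (ℓ .zero) = C at *
    generalize beta ℓ = b at *
    ext i j
    fin_cases i <;> fin_cases j <;> simp [Matrix.mul_apply, Fin.sum_univ_two] <;> field_simp <;> ring
  | one =>
    -- The sign comes from `A_1` having trace `-2 cosh c₃`, while the standard translation has trace
    -- `2 cosh c₃`.
    right
    have hs := Real.sinh_sq (ℓ .zero)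
    have hq := beta_quadratic ℓ
    have e : (A ℓ .one : Matrix (Fin 2) (Fin 2) ℝ) = (!![Real.cosh (ℓ .infty),
        Real.cosh (ℓ .infty) + 1; Real.cosh (ℓ .infty) - 1, Real.cosh (ℓ .infty)] *
        !![Real.cosh (ℓ .zero), -((Real.cosh (ℓ .zero) ^ 2 - 1) / beta ℓ);
          -beta ℓ, Real.cosh (ℓ .zero)]).adjugate := by
      rw [← hs, A, Matrix.SpecialLinearGroup.coe_inv, Matrix.SpecialLinearGroup.coe_mul]
      rfl
    rw [e]
    simp only [Omega, Ainfty, seamLeft]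
    clear e hs
    generalize Real.cosh (ℓ .zero) = C at *
    generalize Real.cosh (ℓ .infty) = B at *
    generalize Real.cosh (ℓ .one) = D at *
    generalize beta ℓ = b at *
    -- Solving the quadratic for `cosh c₃` avoids the square root in `beta` and leaves rational
    -- identities in `B`, `C` and `b`.
    have hD : D = ((B + 1) * b ^ 2 + (B - 1) * (C ^ 2 - 1)) / (2 * b) - B * C := by
      field_simp
      linear_combination -hq
    subst hD
    rw [Matrix.adjugate_fin_two]
    ext i j
    fin_cases i <;> fin_cases j <;> simp [Matrix.mul_apply, Fin.sum_univ_two] <;> field_simp <;> ring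

theorem endPt_A_smul (ℓ : PantsEnd → ℝ) (ε : PantsEnd) (z : ℍ) :
    endPt ℓ ε (A ℓ ε • z) = stdA (ℓ ε) • endPt ℓ ε z := by
  have h1 := (mob_endPt ℓ ε (A ℓ ε • z)).comp (mob_smul (A ℓ ε) z)
  have h2 := (mob_smul (stdA (ℓ ε)) (endPt ℓ ε z)).comp (mob_endPt ℓ ε z)
  rw [← cplx_mul] at h1 h2
  rw [UpperHalfPlane.ext_iff]
  rcases Omega_mul_A ℓ ε with h | h <;> rw [h] at h1
  · exact h1.unique h2
  · rw [cplx_neg, mob_neg_iff] at h1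
    exact h1.unique h2

theorem endPt_zpow_smul (ℓ : PantsEnd → ℝ) (ε : PantsEnd) (n : ℤ) (z : ℍ) :
    endPt ℓ ε (A ℓ ε ^ n • z) = stdA (ℓ ε) ^ n • endPt ℓ ε z := by
  induction n generalizing z with
  | zero => simp
  | succ n ih => rw [zpow_add_one, zpow_add_one, mul_smul, mul_smul, ih, endPt_A_smul]
  | pred n ih =>
    rw [zpow_sub_one, zpow_sub_one, mul_smul, mul_smul, ih]
    congr 1
    rw [eq_inv_smul_iff, ← endPt_A_smul, smul_inv_smul]

/-! ### Strips -/

theorem tanh_half_pos {c : ℝ} (hc : 0 < c) : 0 < Real.tanh (c / 2) := by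
  rw [Real.tanh_eq_sinh_div_cosh]
  exact div_pos (Real.sinh_pos_iff.2 (half_pos hc)) (Real.cosh_pos _)

/-- The parameter of the hypercycle through a point. -/
def hyperParam (c : ℝ) (w : ℍ) : ℝ :=
  Real.arctan (((Real.tanh (c / 2))⁻¹ ^ 2 - Complex.normSq w) / (2 * (Real.tanh (c / 2))⁻¹ * w.im))

theorem continuous_hyperParam {c : ℝ} (hc : 0 < c) : Continuous (hyperParam c) := by
  have ht := tanh_half_pos hc
  unfold hyperParam
  refine Real.continuous_arctan.comp (Continuous.div ?_ ?_ fun w => ?_)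
  · exact continuous_const.sub (Complex.continuous_normSq.comp UpperHalfPlane.continuous_coe)
  · exact continuous_const.mul UpperHalfPlane.continuous_im
  · have := w.im_pos
    positivity

/-- Squaring the equation of the circle cancels `κ² tan² θ` and leaves an equation linear in `tan
θ`. So each point lies on exactly one hypercycle, and a strip is given by an open condition on a
continuous parameter. -/
theorem onHypercycle_iff {c : ℝ} (hc : 0 < c) {θ : ℝ} (w : ℍ) :
    OnHypercycle c θ w ↔ θ = hyperParam c w := by
  have ht := tanh_half_pos hc
  have hw := w.im_pos
  unfold hyperParam OnHypercycle
  set κ := (Real.tanh (c / 2))⁻¹ with hκ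
  have hκ0 : 0 < κ := inv_pos.2 ht
  have key : ∀ θ ∈ Set.Ioo (-(Real.pi / 2)) (Real.pi / 2),
      (‖(w : ℂ) + Complex.I * (κ * Real.tan θ : ℝ)‖ = κ / Real.cos θ ↔
        Real.tan θ = (κ ^ 2 - Complex.normSq w) / (2 * κ * w.im)) := by
    intro θ hθ
    have hcos := Real.cos_pos_of_mem_Ioo hθ
    rw [← sq_eq_sq₀ (norm_nonneg _) (by positivity), ← Complex.normSq_eq_norm_sq,
      eq_div_iff (by positivity), div_pow, div_eq_mul_inv, ← Real.inv_one_add_tan_sq hcos.ne',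
      inv_inv]
    simp only [Complex.normSq_apply]
    simp [-Complex.ofReal_tan]
    constructor <;> intro h <;> nlinarith
  constructor
  · rintro ⟨h1, h2⟩
    rw [← (key θ h1).1 h2, Real.arctan_tan h1.1 h1.2]
  · rintro rfl
    refine ⟨Real.arctan_mem_Ioo _, (key _ (Real.arctan_mem_Ioo _)).2 (Real.tan_arctan _)⟩

theorem mem_strip_iff {ℓ : PantsEnd → ℝ} {ε : PantsEnd} (hε : 0 < ℓ ε) {μ : ℂ} {ν : ℝ} {z : ℍ} :
    z ∈ strip ℓ ε μ ν ↔ |hyperParam (ℓ ε) (endPt ℓ ε z) - μ.im / 2| < ν := by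
  simp only [strip, ← coe_endPt, onHypercycle_iff hε]
  constructor
  · rintro ⟨θ, h, rfl⟩
    exact h
  · exact fun h => ⟨_, h, rfl⟩

theorem isOpen_strip {ℓ : PantsEnd → ℝ} {ε : PantsEnd} (hε : 0 < ℓ ε) (μ : ℂ) (ν : ℝ) :
    IsOpen (strip ℓ ε μ ν) := by
  have : strip ℓ ε μ ν = {z | |hyperParam (ℓ ε) (endPt ℓ ε z) - μ.im / 2| < ν} :=
    Set.ext fun z => mem_strip_iff hε
  rw [this]
  exact isOpen_lt (((continuous_hyperParam hε).comp (continuous_endPt ℓ ε)).sub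
    continuous_const).abs continuous_const

theorem hypercycle_subset_strip {ℓ : PantsEnd → ℝ} {ε : PantsEnd} {μ : ℂ} {ν : ℝ} (hν : 0 < ν) :
    hypercycle ℓ ε μ ⊆ strip ℓ ε μ ν :=
  fun _ h => ⟨μ.im / 2, by simpa using hν, h⟩

/-! ### Discreteness of the translations -/

theorem coth_half {c : ℝ} (hc : 0 < c) :
    (Real.tanh (c / 2))⁻¹ * (Real.cosh c - 1) = Real.sinh c ∧
    Real.tanh (c / 2) * (Real.cosh c + 1) = Real.sinh c := by
  have h1 := Real.sinh_pos_iff.2 (half_pos hc)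
  have h2 := Real.cosh_pos (c / 2)
  have e1 : Real.sinh c = 2 * Real.sinh (c / 2) * Real.cosh (c / 2) := by
    rw [← Real.sinh_two_mul]; congr 1; ring
  have e2 : Real.cosh c = Real.cosh (c / 2) ^ 2 + Real.sinh (c / 2) ^ 2 := by
    rw [← Real.cosh_two_mul]; congr 1; ring
  have e3 := Real.cosh_sq (c / 2)
  rw [Real.tanh_eq_sinh_div_cosh, e1, e2, inv_div]
  constructor
  · field_simp
    linear_combination (1 : ℝ) * e3
  · field_simp
    linear_combination -(1 : ℝ) * e3

/-- The signed position of the foot point on the geodesic from `-coth (c/2)` to `coth (c/2)`. -/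
def axisPos (c : ℝ) (w : ℍ) : ℝ :=
  Real.log (‖(w : ℂ) + ((Real.tanh (c / 2))⁻¹ : ℝ)‖ / ‖(w : ℂ) - ((Real.tanh (c / 2))⁻¹ : ℝ)‖)

theorem coe_add_ofReal_ne_zero (w : ℍ) (x : ℝ) : (w : ℂ) + x ≠ 0 := by
  intro h
  have := congrArg Complex.im h
  simp at this
  exact w.im_ne_zero this

theorem coe_sub_ofReal_ne_zero (w : ℍ) (x : ℝ) : (w : ℂ) - x ≠ 0 := by
  simpa [sub_eq_add_neg] using coe_add_ofReal_ne_zero w (-x)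

theorem continuous_axisPos (c : ℝ) : Continuous (axisPos c) := by
  unfold axisPos
  refine Continuous.log (Continuous.div ?_ ?_ fun w => ?_) fun w => ?_
  · exact (UpperHalfPlane.continuous_coe.add continuous_const).norm
  · exact (UpperHalfPlane.continuous_coe.sub continuous_const).norm
  · exact norm_ne_zero_iff.2 (coe_sub_ofReal_ne_zero _ _)
  · exact div_ne_zero (norm_ne_zero_iff.2 (coe_add_ofReal_ne_zero _ _))
      (norm_ne_zero_iff.2 (coe_sub_ofReal_ne_zero _ _))

/-- The points `± coth (c/2)` are fixed, and up to the common denominator the distances to them are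
multiplied by `exp c` and `exp (-c)`. -/
theorem axisPos_stdA_smul {c : ℝ} (hc : 0 < c) (w : ℍ) :
    axisPos c (stdA c • w) = axisPos c w + 2 * c := by
  obtain ⟨k1, k2⟩ := coth_half hc
  have ht := (tanh_half_pos hc).ne'
  obtain ⟨hd, hn⟩ := mob_smul (stdA c) w
  set v : ℂ := ((stdA c • w : ℍ) : ℂ)
  simp only [cplx, Ainfty, Matrix.map_apply, Matrix.of_apply, Matrix.cons_val', Matrix.cons_val_zero,
    Matrix.cons_val_one, Matrix.cons_val_fin_one, Complex.coe_algebraMap] at hd hn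
  unfold axisPos
  set κ : ℝ := (Real.tanh (c / 2))⁻¹ with hκ
  have k3 : κ * Real.sinh c = Real.cosh c + 1 := by
    rw [← k2, hκ]; field_simp
  have k1' : (κ : ℂ) * ((Real.cosh c - 1 : ℝ) : ℂ) = (Real.sinh c : ℝ) := by
    rw [← Complex.ofReal_mul, k1]
  have k3' : (κ : ℂ) * (Real.sinh c : ℝ) = ((Real.cosh c + 1 : ℝ) : ℂ) := by
    rw [← Complex.ofReal_mul, k3]
  have p1 : v + κ = Real.exp c * (w + κ) /
      (((Real.cosh c - 1 : ℝ) : ℂ) * w + (Real.cosh c : ℝ)) := by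
    rw [eq_div_iff hd, add_mul, ← hn, ← Real.cosh_add_sinh, Complex.ofReal_add _ (Real.sinh c)]
    linear_combination (-1 : ℂ) * k3' + w * k1'
  have p2 : v - κ = Real.exp (-c) * (w - κ) /
      (((Real.cosh c - 1 : ℝ) : ℂ) * w + (Real.cosh c : ℝ)) := by
    rw [eq_div_iff hd, sub_mul, ← hn, ← Real.cosh_sub_sinh, Complex.ofReal_sub _ (Real.sinh c)]
    linear_combination (-1 : ℂ) * k3' - w * k1'
  have q1 := norm_ne_zero_iff.2 (coe_add_ofReal_ne_zero w κ)
  have q2 := norm_ne_zero_iff.2 (coe_sub_ofReal_ne_zero w κ)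
  have q3 := norm_ne_zero_iff.2 hd
  generalize ((Real.cosh c - 1 : ℝ) : ℂ) * w + (Real.cosh c : ℝ) = d at *
  have e : ‖v + κ‖ / ‖v - κ‖ = Real.exp (2 * c) * (‖(w : ℂ) + κ‖ / ‖(w : ℂ) - κ‖) := by
    rw [p1, p2, norm_div, norm_div, norm_mul, norm_mul, Complex.norm_real, Complex.norm_real,
      Real.norm_of_nonneg (Real.exp_pos _).le, Real.norm_of_nonneg (Real.exp_pos _).le,
      Real.exp_neg, two_mul, Real.exp_add]
    field_simp
  rw [e, Real.log_mul (Real.exp_pos _).ne' (div_ne_zero q1 q2), Real.log_exp]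
  ring

theorem axisPos_zpow_smul {c : ℝ} (hc : 0 < c) (n : ℤ) (w : ℍ) :
    axisPos c (stdA c ^ n • w) = axisPos c w + 2 * c * n := by
  induction n generalizing w with
  | zero => simp
  | succ n ih =>
    rw [zpow_add_one, mul_smul, ih, axisPos_stdA_smul hc]
    push_cast
    ring
  | pred n ih =>
    have := axisPos_stdA_smul hc ((stdA c)⁻¹ • w)
    rw [smul_inv_smul] at this
    rw [zpow_sub_one, mul_smul, ih, this]
    push_cast
    ring

theorem exists_nhds_A_zpow {ℓ : PantsEnd → ℝ} {ε : PantsEnd} (hε : 0 < ℓ ε) (z₀ : ℍ) :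
    ∃ U ∈ 𝓝 z₀, ∀ z ∈ U, ∀ n : ℤ, A ℓ ε ^ n • z ∈ U → n = 0 := by
  have hcont := (continuous_axisPos (ℓ ε)).comp (continuous_endPt ℓ ε)
  -- Positions in a ball of radius `ℓ ε` differ by less than `2 * ℓ ε`, whereas the `n`-th power
  -- shifts them by `2 * ℓ ε * n`.
  refine ⟨_, hcont.continuousAt.preimage_mem_nhds (Metric.ball_mem_nhds _ hε), fun z hz n hn => ?_⟩
  simp only [Set.mem_preimage, Function.comp_apply, Metric.mem_ball, Real.dist_eq] at hz hn
  rw [endPt_zpow_smul, axisPos_zpow_smul hε] at hn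
  rw [abs_lt] at hz hn
  have h1 : (n : ℝ) < 1 := by
    by_contra! h
    nlinarith
  have h2 : (-1 : ℝ) < n := by
    by_contra! h
    nlinarith
  have h1' : n < 1 := by exact_mod_cast h1
  have h2' : -1 < n := by exact_mod_cast h2
  omega

/-! ### The gluing map -/

/-- The matrix of the gluing map in the coordinates of the ends. -/
abbrev glueMat (c : ℝ) (μ : ℂ) : Matrix (Fin 2) (Fin 2) ℂ := T c μ * J c

theorem glueMat_eq {c : ℝ} (hc : 0 < c) (μ : ℂ) : glueMat c μ =
    !![-Complex.sinh (μ / 2), -Complex.cosh (μ / 2) * ((Real.tanh (c / 2))⁻¹ : ℝ);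
      Complex.cosh (μ / 2) * (Real.tanh (c / 2) : ℝ), Complex.sinh (μ / 2)] := by
  have ht : (Real.tanh (c / 2) : ℂ) ≠ 0 := by
    exact_mod_cast (tanh_half_pos hc).ne'
  rw [glueMat, T, J, Complex.ofReal_inv]
  ext i j
  fin_cases i <;> fin_cases j <;> simp [-Complex.ofReal_tanh] <;> field_simp

theorem det_glueMat {c : ℝ} (hc : 0 < c) (μ : ℂ) : (glueMat c μ).det = 1 := by
  have ht : (Real.tanh (c / 2) : ℂ) ≠ 0 := by
    exact_mod_cast (tanh_half_pos hc).ne'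
  rw [glueMat_eq hc, Matrix.det_fin_two_of, Complex.ofReal_inv]
  have := Complex.cosh_sq (μ / 2)
  field_simp
  linear_combination this

/-- The gluing matrix has determinant one and trace zero, so its adjugate is its negative: the
gluing map is an involution. -/
theorem mob_glueMat_symm {c : ℝ} (hc : 0 < c) {μ z w : ℂ} (h : Mob (glueMat c μ) z w) :
    Mob (glueMat c μ) w z := by
  have := h.adjugate (by rw [det_glueMat hc]; exact one_ne_zero)
  have e : (glueMat c μ).adjugate = -glueMat c μ := by
    rw [glueMat_eq hc, Matrix.adjugate_fin_two]
    ext i j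
    fin_cases i <;> fin_cases j <;> simp
  rwa [e, mob_neg_iff] at this

/-- `T_μ` shares its axis with the standard translation and commutes with it, while `J` reverses the
axis and conjugates the translation to its inverse. -/
theorem glueMat_mul_stdA {c : ℝ} (hc : 0 < c) (μ : ℂ) :
    cplx (stdA c) * (glueMat c μ * cplx (stdA c)) = glueMat c μ := by
  obtain ⟨k1, k2⟩ := coth_half hc
  have h : ((Real.tanh (c / 2))⁻¹ : ℝ) * ((Real.cosh c : ℂ) - 1) =
      (Real.tanh (c / 2) : ℝ) * ((Real.cosh c : ℂ) + 1) := by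
    exact_mod_cast k1.trans k2.symm
  have e : cplx (stdA c) = !![(Real.cosh c : ℂ), (Real.cosh c : ℂ) + 1;
      (Real.cosh c : ℂ) - 1, (Real.cosh c : ℂ)] := by
    ext i j
    fin_cases i <;> fin_cases j <;> simp [cplx, Ainfty]
  rw [glueMat_eq hc, e]
  generalize Complex.sinh (μ / 2) = s at *
  generalize Complex.cosh (μ / 2) = k at *
  generalize (((Real.tanh (c / 2))⁻¹ : ℝ) : ℂ) = κ at *
  generalize (Real.tanh (c / 2) : ℂ) = t at *
  generalize (Real.cosh c : ℂ) = C at *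
  rw [Matrix.mul_fin_two, Matrix.mul_fin_two]
  ext i j
  fin_cases i <;> fin_cases j <;> simp only [Fin.zero_eta, Fin.mk_one, Fin.isValue, Matrix.of_apply,
    Matrix.cons_val', Matrix.cons_val_zero, Matrix.cons_val_one, Matrix.cons_val_fin_one]
  · linear_combination -k * C * h
  · linear_combination -k * (C + 1) * h
  · linear_combination -k * (C - 1) * h
  · linear_combination -k * C * h

theorem mob_glueMat_stdA {c : ℝ} (hc : 0 < c) {μ : ℂ} {u v : ℍ} (h : Mob (glueMat c μ) u v) :
    Mob (glueMat c μ) (stdA c • u : ℍ) ((stdA c)⁻¹ • v : ℍ) := by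
  have hdet : (cplx (stdA c)).det ≠ 0 := by rw [det_cplx, (stdA c).det_coe]; simp
  have h1 : Mob (cplx (stdA c)) ((stdA c)⁻¹ • v : ℍ) v := by
    have := mob_smul (stdA c) ((stdA c)⁻¹ • v)
    rwa [smul_inv_smul] at this
  rw [← glueMat_mul_stdA hc] at h
  exact (h.of_comp hdet h1).of_comp_right hdet (mob_smul _ _)

theorem mob_glueMat_zpow {c : ℝ} (hc : 0 < c) {μ : ℂ} (n : ℤ) {u v : ℍ}
    (h : Mob (glueMat c μ) u v) :
    Mob (glueMat c μ) (stdA c ^ n • u : ℍ) (stdA c ^ (-n) • v : ℍ) := by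
  induction n generalizing u v with
  | zero => simpa using h
  | succ n ih =>
    have := ih (mob_glueMat_stdA hc h)
    rw [zpow_add_one, mul_smul, show -((n : ℤ) + 1) = -n - 1 by ring, zpow_sub_one, mul_smul]
    exact this
  | pred n ih =>
    have := ih (mob_glueMat_symm hc (mob_glueMat_stdA hc (mob_glueMat_symm hc h)))
    rw [zpow_sub_one, mul_smul, show -(-(n : ℤ) - 1) = - -n + 1 by ring, zpow_add_one, mul_smul]
    exact this

theorem Mob.eventually {N : Matrix (Fin 2) (Fin 2) ℂ} {z₀ w₀ : ℍ} (h : Mob N z₀ w₀) {U : Set ℍ}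
    (hU : U ∈ 𝓝 w₀) : ∀ᶠ z : ℍ in 𝓝 z₀, ∃ w ∈ U, Mob N z w := by
  have hden : ContinuousAt (fun z : ℍ => N 1 0 * (z : ℂ) + N 1 1) z₀ := by fun_prop
  have hcont : ContinuousAt (fun z : ℍ => moeb N z) z₀ := by
    unfold moeb
    exact ContinuousAt.div (by fun_prop) hden h.1
  have him := UpperHalfPlane.isOpenEmbedding_coe.image_mem_nhds.2 hU
  rw [h.eq_moeb] at him
  filter_upwards [hcont.preimage_mem_nhds him, hden.eventually_ne h.1] with z ⟨w, hw, e⟩ hd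
  exact ⟨w, hw, mob_moeb (UpperHalfPlane.ne_zero _) e⟩

theorem det_mul_ne_zero {M N : Matrix (Fin 2) (Fin 2) ℂ} (hM : M.det ≠ 0) (hN : N.det ≠ 0) :
    (M * N).det ≠ 0 := by
  rw [Matrix.det_mul]
  exact mul_ne_zero hM hN

/-! ### Points identified with a point of a strip -/

namespace PantsDecomposition

variable (D : PantsDecomposition) (c : Fin D.numCurves → ℝ) (μ : Fin D.numCurves → ℂ)
  (ν : Fin D.numCurves → ℝ)

/-- A pants curve with its two sides. -/
structure TwoSides where
  curve : Fin D.numCurves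
  j : Fin D.numPants
  ε : PantsEnd
  j' : Fin D.numPants
  ε' : PantsEnd
  ne : (j, ε) ≠ (j', ε')
  label : D.label (j, ε) = some curve
  label' : D.label (j', ε') = some curve
  eq_or_eq : ∀ s, D.label s = some curve → s = (j, ε) ∨ s = (j', ε')

variable {D}

theorem exists_twoSides {i : Fin D.numCurves} {j : Fin D.numPants} {ε : PantsEnd}
    (h : D.label (j, ε) = some i) : ∃ S : D.TwoSides, S.curve = i ∧ S.j = j ∧ S.ε = ε := by
  obtain ⟨a, b, hab, e⟩ := Set.ncard_eq_two.1 (D.two_sides i)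
  have ha : D.label a = some i := by
    have : a ∈ {s | D.label s = some i} := e ▸ Set.mem_insert _ _
    exact this
  have hb : D.label b = some i := by
    have : b ∈ {s | D.label s = some i} := e ▸ Set.mem_insert_of_mem _ rfl
    exact this
  have hall : ∀ s, D.label s = some i → s = a ∨ s = b := by
    intro s hs
    have : s ∈ ({a, b} : Set _) := e ▸ (show s ∈ {s | D.label s = some i} from hs)
    simpa using this
  rcases hall _ h with rfl | rfl
  · exact ⟨⟨i, j, ε, b.1, b.2, hab, ha, hb, hall⟩, rfl, rfl, rfl⟩
  · exact ⟨⟨i, j, ε, a.1, a.2, hab.symm, hb, ha, fun s hs => (hall s hs).symm⟩, rfl, rfl, rfl⟩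

/-- The same curve with its sides exchanged. -/
def TwoSides.symm (S : D.TwoSides) : D.TwoSides where
  curve := S.curve
  j := S.j'
  ε := S.ε'
  j' := S.j
  ε' := S.ε
  ne := S.ne.symm
  label := S.label'
  label' := S.label
  eq_or_eq s hs := (S.eq_or_eq s hs).symm

theorem halfLength_of_label {i : Fin D.numCurves} {j : Fin D.numPants} {ε : PantsEnd}
    (h : D.label (j, ε) = some i) : D.halfLength c j ε = c i := by
  rw [halfLength, h]; rfl

/-- The strip of the first side of a curve. -/
abbrev TwoSides.strip (S : D.TwoSides) : Set ℍ :=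
  CGluing.strip (D.halfLength c S.j) S.ε (μ S.curve) (ν S.curve)

/-- The coordinate of the first side of a curve. -/
abbrev TwoSides.pt (S : D.TwoSides) (z : ℍ) : ℍ := endPt (D.halfLength c S.j) S.ε z

/-- The boundary element of the first side of a curve. -/
abbrev TwoSides.elt (S : D.TwoSides) : SL(2, ℝ) := A (D.halfLength c S.j) S.ε

/-- A point of the strip of the first side is identified with a point of the strip of the second
side. -/
structure TwoSides.Glued (S : D.TwoSides) (z w : ℍ) : Prop where
  mem : z ∈ S.strip c μ ν
  mem' : w ∈ S.symm.strip c μ ν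
  mob : Mob (glueMat (c S.curve) (μ S.curve)) (S.pt c z) (S.symm.pt c w)

/-- The normal form of the points of the upper half-planes that are equivalent to a point `z` of
the strip of the first side of a curve. -/
def TwoSides.Reach (S : D.TwoSides) (z : ℍ) (k : Fin D.numPants) (w : ℍ) : Prop :=
  (k = S.j ∧ ∃ g ∈ D.group c S.j, w = g • z) ∨
    (k = S.j' ∧ ∃ g ∈ D.group c S.j, ∃ z', S.Glued c μ ν (g • z) z' ∧
      ∃ g' ∈ D.group c S.j', w = g' • z')

variable {c μ ν}

theorem TwoSides.halfLength_eq (S : D.TwoSides) : D.halfLength c S.j S.ε = c S.curve :=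
  halfLength_of_label c S.label

theorem TwoSides.isOpen_strip (S : D.TwoSides) (hc : ∀ i, 0 < c i) : IsOpen (S.strip c μ ν) :=
  CGluing.isOpen_strip (by rw [S.halfLength_eq]; exact hc _) _ _

theorem TwoSides.elt_mem (S : D.TwoSides) : S.elt c ∈ D.group c S.j :=
  Subgroup.subset_closure ⟨S.ε, rfl⟩

theorem TwoSides.pt_zpow_smul (S : D.TwoSides) (n : ℤ) (z : ℍ) :
    S.pt c (S.elt c ^ n • z) = stdA (c S.curve) ^ n • S.pt c z := by
  rw [TwoSides.pt, endPt_zpow_smul, S.halfLength_eq]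

theorem TwoSides.mem_truncated (S : D.TwoSides) (hν : D.Admissible c μ ν) {z : ℍ}
    (hz : z ∈ S.strip c μ ν) : z ∈ D.truncated c μ ν S.j :=
  hν.subset_truncated _ _ _ S.label hz

theorem smul_mem_truncated {j : Fin D.numPants} {g : SL(2, ℝ)} (hg : g ∈ D.group c j) {z : ℍ}
    (hz : z ∈ D.truncated c μ ν j) : g • z ∈ D.truncated c μ ν j := by
  intro ε i hi h hh
  rw [← mul_smul]
  exact hz ε i hi _ (mul_mem hh hg)

theorem Rel.symm (hc : ∀ i, 0 < c i) {a b : D.Cover c μ ν} (h : D.Rel c μ ν a b) :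
    D.Rel c μ ν b a := by
  cases h with
  | deck j g hg z z' h =>
    exact Rel.deck j g⁻¹ (inv_mem hg) z' z (by rw [h, inv_smul_smul])
  | glue i j j' ε ε' hne hj hj' z z' hz hz' h =>
    refine Rel.glue i j' j ε' ε hne.symm hj' hj z' z hz' hz ?_
    rw [← coe_endPt, ← coe_endPt] at h ⊢
    exact (mob_glueMat_symm (hc i) (mob_moeb (UpperHalfPlane.ne_zero _) h)).eq_moeb

/-- Crossing the curve, moving by `A_ε'^m` and crossing back amounts to `A_ε^(-m)`, since the gluing
map inverts the translation. -/
theorem TwoSides.Glued.unique {S : D.TwoSides} (hc : ∀ i, 0 < c i) {m : ℤ} {z z' z₁ : ℍ}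
    (h : S.Glued c μ ν z z') (h1 : Mob (glueMat (c S.curve) (μ S.curve))
      (S.symm.pt c (S.symm.elt c ^ m • z')) (S.pt c z₁)) : z₁ = S.elt c ^ (-m) • z := by
  have h2 := mob_glueMat_zpow (hc _) m (mob_glueMat_symm (hc _) h.mob)
  rw [S.symm.pt_zpow_smul] at h1
  have h3 := h1.unique h2
  rw [← UpperHalfPlane.ext_iff, ← S.pt_zpow_smul] at h3
  exact endPt_injective _ _ h3

/-- A chain of identifications crosses the curve at most once in effect. Disjointness of the annuli
allows a translate of a strip point to cross only this curve, on its own side. To cross back, the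
group element used in between must by embeddedness be a power of `A_ε'`, and the return lands in the
orbit of `z`. -/
theorem TwoSides.Reach.step {S : D.TwoSides} (hc : ∀ i, 0 < c i) (hν : D.Admissible c μ ν)
    {z : ℍ} (hz : z ∈ S.strip c μ ν) {a b : D.Cover c μ ν} (hab : D.Rel c μ ν a b)
    (h : S.Reach c μ ν z a.1 a.2) : S.Reach c μ ν z b.1 b.2 := by
  cases hab with
  | deck k g hg w w' hw =>
    rcases h with ⟨e, g₁, hg₁, h⟩ | ⟨e, g₁, hg₁, z', hz', g₂, hg₂, h⟩
    · dsimp only at e h ⊢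
      subst e
      exact Or.inl ⟨rfl, g * g₁, mul_mem hg hg₁, by rw [hw, h, mul_smul]⟩
    · dsimp only at e h ⊢
      subst e
      exact Or.inr ⟨rfl, g₁, hg₁, z', hz', g * g₂, mul_mem hg hg₂, by rw [hw, h, mul_smul]⟩
  | glue i k k' δ δ' hne hk hk' w w' hw hw' hm =>
    rw [← coe_endPt, ← coe_endPt] at hm
    have hmob := mob_moeb (UpperHalfPlane.ne_zero _) hm
    rcases h with ⟨e, g₁, hg₁, h⟩ | ⟨e, g₁, hg₁, z', hz', g₂, hg₂, h⟩
    · dsimp only at e h ⊢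
      subst e
      have e2 : δ = S.ε := by
        by_contra hne'
        refine hν.disjoint S.j S.ε δ _ _ (Ne.symm hne') S.label hk g₁ hg₁ z hz ?_
        rw [← h]
        exact hw
      subst e2
      have e3 : S.curve = i := Option.some_injective _ (S.label.symm.trans hk)
      subst e3
      obtain ⟨e4, e5⟩ : k' = S.j' ∧ δ' = S.ε' := by
        rcases S.eq_or_eq _ hk' with e | e
        · exact absurd e.symm hne
        · exact Prod.mk_inj.1 e
      subst e4 e5
      exact Or.inr ⟨rfl, g₁, hg₁, w', ⟨h ▸ hw, hw', by rw [← h]; exact hmob⟩, 1, one_mem _,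
        (one_smul _ _).symm⟩
    · dsimp only at e h ⊢
      subst e
      have e2 : δ = S.ε' := by
        by_contra hne'
        refine hν.disjoint S.j' S.ε' δ _ _ (Ne.symm hne') S.label' hk g₂ hg₂ z' hz'.mem' ?_
        rw [← h]
        exact hw
      subst e2
      have e3 : S.curve = i := Option.some_injective _ (S.label'.symm.trans hk)
      subst e3
      obtain ⟨e4, e5⟩ : k' = S.j ∧ δ' = S.ε := by
        rcases S.eq_or_eq _ hk' with e | e
        · exact Prod.mk_inj.1 e
        · exact absurd e.symm hne
      subst e4 e5
      obtain ⟨m, rfl⟩ := Subgroup.mem_zpowers_iff.1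
        (hν.annulus _ _ _ S.label' g₂ hg₂ z' hz'.mem' (h ▸ hw))
      refine Or.inl ⟨rfl, S.elt c ^ (-m) * g₁, mul_mem (zpow_mem S.elt_mem _) hg₁, ?_⟩
      rw [mul_smul]
      refine hz'.unique hc ?_
      rw [h] at hmob
      exact hmob

/-- Since `Rel` is symmetric, `Reach` holds for both or neither of two identified points. Hence it
descends to the quotient, and no description of the generated equivalence relation is needed. -/
theorem TwoSides.reach_of_proj_eq {S : D.TwoSides} (hc : ∀ i, 0 < c i) (hν : D.Admissible c μ ν)
    {z : D.truncated c μ ν S.j} (hz : (z : ℍ) ∈ S.strip c μ ν) {k : Fin D.numPants}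
    {w : D.truncated c μ ν k} (h : D.proj c μ ν S.j z = D.proj c μ ν k w) :
    S.Reach c μ ν z k w := by
  let P : D.Surface c μ ν → Prop := Quot.lift (fun a : D.Cover c μ ν => S.Reach c μ ν z a.1 a.2)
    fun a b hab => propext ⟨Reach.step hc hν hz hab, Reach.step hc hν hz (hab.symm hc)⟩
  have h1 : P (D.proj c μ ν S.j z) := Or.inl ⟨rfl, 1, one_mem _, (one_smul _ _).symm⟩
  rw [h] at h1
  exact h1

theorem proj_smul {j : Fin D.numPants} {g : SL(2, ℝ)} (hg : g ∈ D.group c j)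
    {z w : D.truncated c μ ν j} (h : (w : ℍ) = g • (z : ℍ)) :
    D.proj c μ ν j w = D.proj c μ ν j z :=
  (Quot.sound (Rel.deck j g hg z w h)).symm

theorem TwoSides.Glued.proj_eq {S : D.TwoSides} {z : D.truncated c μ ν S.j}
    {z' : D.truncated c μ ν S.j'} (h : S.Glued c μ ν z z') :
    D.proj c μ ν S.j z = D.proj c μ ν S.j' z' := by
  refine Quot.sound (Rel.glue S.curve S.j S.j' S.ε S.ε' S.ne S.label S.label' z z' h.mem h.mem' ?_)
  rw [← coe_endPt, ← coe_endPt]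
  exact h.mob.eq_moeb

theorem continuous_proj (j : Fin D.numPants) : Continuous (D.proj c μ ν j) :=
  continuous_quot_mk.comp continuous_sigmaMk

/-- The projection is injective near the points of a strip. -/
theorem TwoSides.exists_nhds_injOn {S : D.TwoSides} (hc : ∀ i, 0 < c i) (hν : D.Admissible c μ ν)
    {z₀ : ℍ} (hz₀ : z₀ ∈ S.strip c μ ν) : ∃ U ∈ 𝓝 z₀, U ⊆ S.strip c μ ν ∧
      ∀ z w : D.truncated c μ ν S.j, (z : ℍ) ∈ U → (w : ℍ) ∈ U →
        D.proj c μ ν S.j z = D.proj c μ ν S.j w → (z : ℍ) = w := by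
  obtain ⟨U, hU, h⟩ := exists_nhds_A_zpow (ℓ := D.halfLength c S.j) (ε := S.ε)
    (by rw [S.halfLength_eq]; exact hc _) z₀
  refine ⟨U ∩ S.strip c μ ν, Filter.inter_mem hU ((S.isOpen_strip hc).mem_nhds hz₀),
    Set.inter_subset_right, fun z w hz hw e => ?_⟩
  rcases S.reach_of_proj_eq hc hν hz.2 e with ⟨-, g, hg, e1⟩ | ⟨e1, g, hg, z', hz', g', hg', e2⟩
  · obtain ⟨m, rfl⟩ := Subgroup.mem_zpowers_iff.1
      (hν.annulus _ _ _ S.label g hg z hz.2 (e1 ▸ hw.2))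
    have := h z hz.1 m (e1 ▸ hw.1)
    rw [e1, this, zpow_zero, one_smul]
  -- This is possible only if both sides of the curve belong to the same pair of pants. Then a
  -- translate of a point of the second strip lies in the first, against disjointness.
  · exfalso
    have hne : S.ε ≠ S.ε' := fun h2 => S.ne (Prod.ext e1 h2)
    refine hν.disjoint S.j' S.ε' S.ε _ _ hne.symm S.label' (e1 ▸ S.label) g' hg' z' hz'.mem' ?_
    rw [← e2]
    have := hw.2
    simp only [TwoSides.strip] at this
    generalize (w : ℍ) = v at this
    rwa [e1] at this

/-! ### Projective charts near a strip -/

/-- The definition of `charts` selects preimages point by point. The selected preimage is the value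
of the chart, so continuity of the chart keeps it near `w₀`. -/
theorem exists_near_chart {φ : OpenPartialHomeomorph (D.Surface c μ ν) (OnePoint ℂ)}
    (hφ : φ ∈ D.charts c μ ν) {x₀ : D.Surface c μ ν} (hx₀ : x₀ ∈ φ.source) :
    ∃ (k : Fin D.numPants) (w₀ : D.truncated c μ ν k), D.proj c μ ν k w₀ = x₀ ∧
      ∀ V ∈ 𝓝 (w₀ : ℍ), ∀ᶠ x in 𝓝 x₀, ∃ w : D.truncated c μ ν k, (w : ℍ) ∈ V ∧
        D.proj c μ ν k w = x ∧ φ x = (((w : ℍ) : ℂ) : OnePoint ℂ) := by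
  obtain ⟨k, hk⟩ := hφ
  obtain ⟨w₀, hw₀, e₀⟩ := hk x₀ hx₀
  have hemb := OnePoint.isOpenEmbedding_coe.comp UpperHalfPlane.isOpenEmbedding_coe
  refine ⟨k, w₀, hw₀, fun V hV => ?_⟩
  have him := hemb.image_mem_nhds.2 hV
  rw [Function.comp_apply, ← e₀] at him
  filter_upwards [φ.open_source.mem_nhds hx₀, (φ.continuousAt hx₀).preimage_mem_nhds him] with
    x hx ⟨v, hv, ev⟩
  obtain ⟨w, hw, e⟩ := hk x hx
  have : v = w := hemb.injective (ev.trans e)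
  exact ⟨w, this ▸ hv, hw, e⟩

/-- The element of `PSL(2, ℂ)` given by a real matrix. -/
def _root_.CGluing.toPSL (g : SL(2, ℝ)) : PSL(2, ℂ) :=
  ((Matrix.SpecialLinearGroup.map (algebraMap ℝ ℂ) g : SL(2, ℂ)) : PSL(2, ℂ))

theorem _root_.CGluing.toPSL_smul (g : SL(2, ℝ)) (z : ℍ) :
    toPSL g • ((z : ℂ) : OnePoint ℂ) = ((g • z : ℍ) : ℂ) :=
  psl_smul (mob_smul g z)

/-- Near a point of a strip, a projective chart is a Möbius transformation. -/
theorem TwoSides.chart_eq {S : D.TwoSides} (hc : ∀ i, 0 < c i) (hν : D.Admissible c μ ν)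
    {φ : OpenPartialHomeomorph (D.Surface c μ ν) (OnePoint ℂ)} (hφ : φ ∈ D.charts c μ ν)
    {z₀ : D.truncated c μ ν S.j} (hz₀ : (z₀ : ℍ) ∈ S.strip c μ ν)
    (hx₀ : D.proj c μ ν S.j z₀ ∈ φ.source) :
    ∃ m : PSL(2, ℂ), ∀ᶠ z in 𝓝 z₀,
      φ (D.proj c μ ν S.j z) = m • (((z : ℍ) : ℂ) : OnePoint ℂ) := by
  obtain ⟨k, w₀, e₀, hnear⟩ := exists_near_chart hφ hx₀
  have hval : Filter.Tendsto ((↑) : D.truncated c μ ν S.j → ℍ) (𝓝 z₀) (𝓝 (z₀ : ℍ)) :=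
    continuous_subtype_val.tendsto z₀
  have hproj := (continuous_proj (c := c) (μ := μ) (ν := ν) S.j).tendsto z₀
  rcases S.reach_of_proj_eq hc hν hz₀ e₀.symm with
    ⟨rfl, g, hg, e1⟩ | ⟨rfl, g, hg, z', hz', g', hg', e2⟩
  -- The chart inverts the projection near `g • z₀`. Pulling its value back by `g⁻¹` gives a point
  -- near `z₀` with the same projection as `z`, hence `z` itself.
  · obtain ⟨U, hU, hUs, hinj⟩ := S.exists_nhds_injOn hc hν hz₀
    have hV : (fun w : ℍ => g⁻¹ • w) ⁻¹' U ∈ 𝓝 (w₀ : ℍ) := by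
      refine (continuous_const_smul g⁻¹).continuousAt.preimage_mem_nhds ?_
      rwa [e1, inv_smul_smul]
    refine ⟨toPSL g, ?_⟩
    filter_upwards [hval hU, hproj.eventually (hnear _ hV)] with z hz ⟨w, hw, e, eφ⟩
    have hwt := S.mem_truncated hν (hUs hw)
    have h1 : D.proj c μ ν S.j ⟨g⁻¹ • (w : ℍ), hwt⟩ = D.proj c μ ν S.j z :=
      (proj_smul (inv_mem hg) rfl).trans e
    have h2 := hinj ⟨g⁻¹ • (w : ℍ), hwt⟩ z hw hz h1
    rw [eφ, toPSL_smul, ← h2, smul_inv_smul]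
  · obtain ⟨U, hU, hUs, hinj⟩ := S.symm.exists_nhds_injOn hc hν hz'.mem'
    have hV : (fun w : ℍ => g'⁻¹ • w) ⁻¹' U ∈ 𝓝 (w₀ : ℍ) := by
      refine (continuous_const_smul g'⁻¹).continuousAt.preimage_mem_nhds ?_
      rwa [e2, inv_smul_smul]
    let Ω := cplx (Omega (D.halfLength c S.j) S.ε)
    let Ω' := cplx (Omega (D.halfLength c S.j') S.ε')
    let G := glueMat (c S.curve) (μ S.curve)
    -- The chart now inverts the projection on the other side. With adjugates for inverses, `N`
    -- below takes `z` to the point glued to `g • z`, and the chart is `g' * N`.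
    let γ := cplx (g : Matrix (Fin 2) (Fin 2) ℝ)
    have hΩ : Ω.det ≠ 0 := det_cplx_Omega _ _
    have hΩ' : Ω'.det ≠ 0 := det_cplx_Omega _ _
    have hγ : ∀ g : SL(2, ℝ), (cplx (g : Matrix (Fin 2) (Fin 2) ℝ)).det ≠ 0 := fun g => by
      rw [det_cplx, g.det_coe]; simp
    have hG : G.det ≠ 0 := by rw [det_glueMat (hc _)]; exact one_ne_zero
    let N := Ω'.adjugate * (G * (Ω * γ))
    have hN₀ : Mob N z₀ z' := ((mob_endPt _ _ z').adjugate hΩ').comp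
      (hz'.mob.comp ((mob_endPt _ _ _).comp (mob_smul g _)))
    have hN : ((cplx (g' : Matrix (Fin 2) (Fin 2) ℝ)) * N).det ≠ 0 := by
      refine det_mul_ne_zero (hγ _) (det_mul_ne_zero ?_ (det_mul_ne_zero hG (det_mul_ne_zero hΩ (hγ _))))
      rw [Matrix.det_adjugate]
      exact pow_ne_zero _ hΩ'
    obtain ⟨m, hm⟩ := exists_psl hN
    refine ⟨m, ?_⟩
    have hgs : ∀ᶠ z in 𝓝 (z₀ : ℍ), g • z ∈ S.strip c μ ν :=
      (continuous_const_smul g).continuousAt.preimage_mem_nhds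
        ((S.isOpen_strip hc).mem_nhds hz'.mem)
    filter_upwards [hval.eventually hgs, hval.eventually (hN₀.eventually hU),
      hproj.eventually (hnear _ hV)] with z hz ⟨y, hy, hNy⟩ ⟨w, hw, e, eφ⟩
    have hglue : S.Glued c μ ν (g • (z : ℍ)) y := by
      refine ⟨hz, hUs hy, ?_⟩
      have h1 : Mob (Ω' * N) z (S.symm.pt c y) := (mob_endPt _ _ y).comp hNy
      rw [← mul_assoc, Matrix.mul_adjugate, smul_mul_assoc, one_mul, mob_smul_iff hΩ'] at h1
      exact h1.of_comp_right (det_mul_ne_zero hΩ (hγ _))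
        ((mob_endPt _ _ _).comp (mob_smul g _))
    have hyt := S.symm.mem_truncated hν (hUs hy)
    have hwt := S.symm.mem_truncated hν (hUs hw)
    have h1 : D.proj c μ ν S.j' ⟨y, hyt⟩ = D.proj c μ ν S.j' ⟨g'⁻¹ • (w : ℍ), hwt⟩ := by
      rw [proj_smul (inv_mem hg') (z := w) (w := ⟨g'⁻¹ • (w : ℍ), hwt⟩) rfl, e, ← proj_smul hg (z := z)
        (w := ⟨_, smul_mem_truncated hg z.2⟩) rfl]
      exact (TwoSides.Glued.proj_eq (z := ⟨_, smul_mem_truncated hg z.2⟩) (z' := ⟨y, hyt⟩) hglue).symm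
    have h2 : y = g'⁻¹ • (w : ℍ) := hinj ⟨y, hyt⟩ ⟨g'⁻¹ • (w : ℍ), hwt⟩ hy hw h1
    have h3 : (w : ℍ) = g' • y := by rw [h2, smul_inv_smul]
    rw [eφ, h3]
    exact (hm _ _ ((mob_smul g' y).comp hNy)).symm

end PantsDecomposition

/-! ### Coverings, deck transformations and free homotopies -/

section Covering

variable {E X : Type*} [TopologicalSpace E] [TopologicalSpace X] {p : E → X}

/-- The homeomorphism `τ` takes the initial point of some lift of the loop `α` to its end point. -/
def Translates (p : E → X) (τ : E ≃ₜ E) {x : X} (α : Path x x) : Prop :=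
  ∃ Γ : C(I, E), (∀ t, p (Γ t) = α t) ∧ Γ 1 = τ (Γ 0)

theorem Translates.symm {τ : E ≃ₜ E} {x : X} {α : Path x x} (h : Translates p τ α) :
    Translates p τ.symm α.symm := by
  obtain ⟨Γ, h1, h2⟩ := h
  refine ⟨Γ.comp ⟨σ, unitInterval.continuous_symm⟩, fun t => h1 _, ?_⟩
  simp [h2]

/-- Lift the homotopy `F` from the given lift of `α`. The lifts of its two sides, one moved by `τ`,
lie over the same path because `F (s, 0) = F (s, 1)`. They agree at `s = 0`, hence also at `s = 1`.
-/
theorem Translates.of_freelyHomotopic (hp : IsCoveringMap p) {τ : E ≃ₜ E}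
    (hτ : ∀ y, p (τ y) = p y) {x y : X} {α : Path x x} {β : Path y y} (h : Translates p τ α)
    (hαβ : FreelyHomotopic α β) : Translates p τ β := by
  obtain ⟨Γ, h1, h2⟩ := h
  obtain ⟨F, hF0, hF1, hF⟩ := hαβ
  have H0 : ∀ t, F (0, t) = p (Γ t) := fun t => (hF0 t).trans (h1 t).symm
  let L : C(I × I, E) := hp.liftHomotopy F Γ H0
  have hL : ∀ q, p (L q) = F q := fun q => congrFun (hp.liftHomotopy_lifts F Γ H0) q
  have hL0 : ∀ t, L (0, t) = Γ t := hp.liftHomotopy_zero F Γ H0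
  have key : (fun s => L (s, 1)) = fun s => τ (L (s, 0)) := by
    refine hp.eq_of_comp_eq (by fun_prop) (by fun_prop) (funext fun s => ?_) 0 ?_
    · simp [hτ, hL, hF]
    · simp [hL0, h2]
  exact ⟨L.comp ⟨fun t => (1, t), by fun_prop⟩, fun t => (hL _).trans (hF1 t), congrFun key 1⟩

theorem Translates.of_homotopicCurves (hp : IsCoveringMap p) {τ : E ≃ₜ E}
    (hτ : ∀ y, p (τ y) = p y) {x y : X} {α : Path x x} {β : Path y y} (h : Translates p τ α)
    (hαβ : HomotopicCurves α β) : Translates p τ β ∨ Translates p τ.symm β := by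
  rcases hαβ with hαβ | hαβ
  · exact Or.inl (h.of_freelyHomotopic hp hτ hαβ)
  · refine Or.inr ?_
    have := (h.of_freelyHomotopic hp hτ hαβ).symm
    rwa [Path.symm_symm] at this

theorem HomotopicCurves.map {Y : Type*} [TopologicalSpace Y] {x y : X} {α : Path x x}
    {β : Path y y} (h : HomotopicCurves α β) {f : X → Y} (hf : Continuous f) :
    HomotopicCurves (α.map hf) (β.map hf) := by
  have key : ∀ {β : Path y y}, FreelyHomotopic α β → FreelyHomotopic (α.map hf) (β.map hf) := by
    rintro β ⟨F, h0, h1, h2⟩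
    exact ⟨ContinuousMap.comp ⟨f, hf⟩ F, fun t => congrArg f (h0 t), fun t => congrArg f (h1 t),
      fun s => congrArg f (h2 s)⟩
  refine h.imp key fun h => ?_
  rw [Path.map_symm]
  exact key h

/-- Lift `p` through itself with the base points in either order. Both composites are lifts of `p`
with a fixed point, hence the identity. -/
theorem exists_deck [SimplyConnectedSpace E] [LocallyPathConnectedSpace E] (hp : IsCoveringMap p)
    {e₀ e₁ : E} (h : p e₁ = p e₀) : ∃ τ : E ≃ₜ E, (∀ y, p (τ y) = p y) ∧ τ e₀ = e₁ := by
  obtain ⟨F, ⟨hF0, hF⟩, -⟩ := hp.existsUnique_continuousMap_lifts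
    (⟨p, hp.continuous⟩ : C(E, X)) e₀ e₁ h
  obtain ⟨G, ⟨hG0, hG⟩, -⟩ := hp.existsUnique_continuousMap_lifts
    (⟨p, hp.continuous⟩ : C(E, X)) e₁ e₀ h.symm
  have hF' : ∀ y, p (F y) = p y := congrFun hF
  have hG' : ∀ y, p (G y) = p y := congrFun hG
  have h1 : G ∘ F = id := hp.eq_of_comp_eq (by fun_prop) continuous_id
    (funext fun y => by simp [hF', hG']) e₀ (by simp [hF0, hG0])
  have h2 : F ∘ G = id := hp.eq_of_comp_eq (by fun_prop) continuous_id
    (funext fun y => by simp [hF', hG']) e₁ (by simp [hF0, hG0])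
  exact ⟨⟨⟨F, G, congrFun h1, congrFun h2⟩, F.continuous, G.continuous⟩, hF', hF0⟩

end Covering

/-! ### Conjugation to a dilation -/

theorem coe_neg_psl (a : SL(2, ℂ)) : ((-a : SL(2, ℂ)) : PSL(2, ℂ)) = a := by
  rw [QuotientGroup.eq, Matrix.SpecialLinearGroup.mem_center_iff]
  refine ⟨-1, by simp, ?_⟩
  have : (-a)⁻¹ * a = -1 := by
    rw [inv_mul_eq_iff_eq_mul]; simp
  rw [this]
  ext i j
  fin_cases i <;> fin_cases j <;> simp

theorem isConj_psl {a b : SL(2, ℂ)} {M : Matrix (Fin 2) (Fin 2) ℂ} (hM : M.det ≠ 0)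
    (h : (a : Matrix (Fin 2) (Fin 2) ℂ) * M = M * (b : Matrix (Fin 2) (Fin 2) ℂ) ∨
      (a : Matrix (Fin 2) (Fin 2) ℂ) * M = -(M * (b : Matrix (Fin 2) (Fin 2) ℂ))) :
    IsConj (a : PSL(2, ℂ)) (b : PSL(2, ℂ)) := by
  obtain ⟨s, hs⟩ := IsAlgClosed.exists_pow_nat_eq M.det (n := 2) (by norm_num)
  have hs0 : s ≠ 0 := by
    rintro rfl
    exact hM (by rw [← hs]; norm_num)
  let n : SL(2, ℂ) := ⟨s⁻¹ • M, by rw [Matrix.det_smul, ← hs]; simp [hs0]⟩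
  have hn : (n : Matrix (Fin 2) (Fin 2) ℂ) = s⁻¹ • M := rfl
  have key : (a : PSL(2, ℂ)) * (n : PSL(2, ℂ)) = (n : PSL(2, ℂ)) * (b : PSL(2, ℂ)) := by
    rw [← QuotientGroup.mk_mul, ← QuotientGroup.mk_mul]
    rcases h with h | h
    · congr 1
      apply Subtype.ext
      rw [Matrix.SpecialLinearGroup.coe_mul, Matrix.SpecialLinearGroup.coe_mul, hn, mul_smul_comm,
        h, smul_mul_assoc]
    · rw [← coe_neg_psl (n * b)]
      congr 1
      apply Subtype.ext
      rw [Matrix.SpecialLinearGroup.coe_neg, Matrix.SpecialLinearGroup.coe_mul,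
        Matrix.SpecialLinearGroup.coe_mul, hn, mul_smul_comm, h, smul_mul_assoc, smul_neg]
  refine (isConj_iff.2 ⟨(n : PSL(2, ℂ)), ?_⟩).symm
  rw [← key, mul_inv_cancel_right]

theorem isConj_toPSL_stdA {c : ℝ} (hc : 0 < c) :
    IsConj (toPSL (stdA c)) (dilation c : PSL(2, ℂ)) := by
  obtain ⟨k1, k2⟩ := coth_half hc
  have ht := (tanh_half_pos hc).ne'
  have e : ((Matrix.SpecialLinearGroup.map (algebraMap ℝ ℂ) (stdA c) : SL(2, ℂ)) :
      Matrix (Fin 2) (Fin 2) ℂ) = cplx !![Real.cosh c, Real.cosh c + 1;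
        Real.cosh c - 1, Real.cosh c] := rfl
  have e2 : (dilation c : Matrix (Fin 2) (Fin 2) ℂ) = cplx !![Real.exp c, 0; 0, Real.exp (-c)] := by
    rw [coe_dilation, Real.exp_neg]
    ext i j
    fin_cases i <;> fin_cases j <;> simp [-Complex.ofReal_exp]
  -- The columns are eigenvectors: homogeneous coordinates of the attracting and the repelling fixed
  -- point `± coth (c/2)`.
  refine isConj_psl (M := cplx !![(Real.tanh (c / 2))⁻¹, -(Real.tanh (c / 2))⁻¹; 1, 1]) ?_ (Or.inl ?_)
  · rw [det_cplx, Matrix.det_fin_two_of]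
    have : (Real.tanh (c / 2))⁻¹ ≠ 0 := inv_ne_zero ht
    exact_mod_cast (by simpa [← two_mul] using this)
  · rw [e, e2, ← cplx_mul, ← cplx_mul, Matrix.mul_fin_two, Matrix.mul_fin_two, ← Real.cosh_add_sinh,
      ← Real.cosh_sub_sinh]
    have k3 : (Real.tanh (c / 2))⁻¹ * Real.sinh c = Real.cosh c + 1 := by
      rw [← k2]; field_simp
    generalize (Real.tanh (c / 2))⁻¹ = κ at *
    generalize Real.sinh c = s at *
    generalize Real.cosh c = C at *
    congr 1
    ext i j
    fin_cases i <;> fin_cases j <;> simp only [Fin.zero_eta, Fin.mk_one, Fin.isValue,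
      Matrix.of_apply, Matrix.cons_val', Matrix.cons_val_zero, Matrix.cons_val_one,
      Matrix.cons_val_fin_one]
    · linear_combination -k3
    · linear_combination -k3
    · linear_combination k1
    · linear_combination -k1

theorem isConj_toPSL_A {ℓ : PantsEnd → ℝ} {ε : PantsEnd} (hε : 0 < ℓ ε) :
    IsConj (toPSL (A ℓ ε)) (dilation (ℓ ε) : PSL(2, ℂ)) := by
  refine IsConj.trans (IsConj.symm ?_) (isConj_toPSL_stdA hε)
  refine isConj_psl (det_cplx_Omega ℓ ε) ?_
  have e : ∀ g : SL(2, ℝ), ((Matrix.SpecialLinearGroup.map (algebraMap ℝ ℂ) g : SL(2, ℂ)) :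
      Matrix (Fin 2) (Fin 2) ℂ) = cplx (g : Matrix (Fin 2) (Fin 2) ℝ) := fun _ => rfl
  rw [e, e, ← cplx_mul, ← cplx_mul, ← cplx_neg]
  rcases Omega_mul_A ℓ ε with h | h
  · exact Or.inl (by rw [h])
  · exact Or.inr (by rw [h, neg_neg])

theorem isConj_dilation_inv (c : ℝ) :
    IsConj ((dilation c : PSL(2, ℂ))⁻¹) (dilation c : PSL(2, ℂ)) := by
  rw [← QuotientGroup.mk_inv]
  -- This matrix exchanges the fixed points `0` and `∞` of the dilation.
  refine isConj_psl (M := !![0, 1; -1, 0]) (by simp [Matrix.det_fin_two_of]) (Or.inl ?_)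
  rw [Matrix.SpecialLinearGroup.coe_inv, coe_dilation, Matrix.adjugate_fin_two]
  ext i j
  fin_cases i <;> fin_cases j <;> simp

theorem isConj_dilation_of_inv {g : PSL(2, ℂ)} {c : ℝ}
    (h : IsConj g⁻¹ (dilation c : PSL(2, ℂ))) : IsConj g (dilation c : PSL(2, ℂ)) := by
  obtain ⟨k, hk⟩ := isConj_iff.1 h
  refine IsConj.trans (isConj_iff.2 ⟨k, ?_⟩) (isConj_dilation_inv c)
  rw [← hk]
  group

/-! ### The developing map along the core loop of an annulus -/

/-- The charts make `E` locally homeomorphic to `ℂ`. Local path connectedness is what the lifting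
criterion in `exists_deck` needs. -/
theorem locallyPathConnectedSpace_of_charts {E X : Type*} [TopologicalSpace E] [TopologicalSpace X]
    {p : E → X} (hp : IsLocalHomeomorph p)
    (h : ∀ y, ∃ φ : OpenPartialHomeomorph X (OnePoint ℂ), p y ∈ φ.source ∧
      ∃ z : ℂ, φ (p y) = (z : OnePoint ℂ)) : LocallyPathConnectedSpace E := by
  choose φ hφ z hz using h
  choose e he hpe using hp
  let κ : OpenPartialHomeomorph (OnePoint ℂ) ℂ :=
    (OnePoint.isOpenEmbedding_coe.toOpenPartialHomeomorph _).symm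
  have hκ : ∀ z : ℂ, (z : OnePoint ℂ) ∈ κ.source := fun z => by simp [κ]
  let _ : ChartedSpace ℂ E :=
    { atlas := Set.range fun y => ((e y).trans (φ y)).trans κ
      chartAt := fun y => ((e y).trans (φ y)).trans κ
      mem_chart_source := fun y => by
        have h1 : e y y = p y := (congrFun (hpe y) y).symm
        simp only [OpenPartialHomeomorph.trans_source, Set.mem_inter_iff, Set.mem_preimage,
          OpenPartialHomeomorph.coe_trans, Function.comp_apply, h1]
        exact ⟨⟨he y, hφ y⟩, by rw [hz]; exact hκ _⟩
      chart_mem_atlas := fun y => ⟨y, rfl⟩ }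
  exact ChartedSpace.locallyPathConnectedSpace ℂ E

namespace PantsDecomposition

variable {D : PantsDecomposition} {c : Fin D.numCurves → ℝ} {μ : Fin D.numCurves → ℂ}
  {ν : Fin D.numCurves → ℝ} {E : Type*} [TopologicalSpace E]

/-- Near `y₀` and `z₀`, the map `dev` is `G` composed with a local inverse of the projection. -/
def IsGerm (p : E → D.Surface c μ ν) (dev : E → OnePoint ℂ) {j : Fin D.numPants} (y₀ : E)
    (z₀ : D.truncated c μ ν j) (G : PSL(2, ℂ)) : Prop :=
  ∀ᶠ q : E × D.truncated c μ ν j in 𝓝 (y₀, z₀), p q.1 = D.proj c μ ν j q.2 →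
    dev q.1 = G • (((q.2 : ℍ) : ℂ) : OnePoint ℂ)

variable {p : E → D.Surface c μ ν} {dev : E → OnePoint ℂ}

/-- A local inverse of `p` supplies the pairs `(s z, z)` with equal projections near `(y₀, z₀)` on
which germs can be compared. -/
theorem exists_section {j : Fin D.numPants} (hp : IsLocalHomeomorph p) {y₀ : E}
    {z₀ : D.truncated c μ ν j} (h : p y₀ = D.proj c μ ν j z₀) :
    ∃ s : D.truncated c μ ν j → E, Filter.Tendsto s (𝓝 z₀) (𝓝 y₀) ∧
      ∀ᶠ z in 𝓝 z₀, p (s z) = D.proj c μ ν j z := by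
  obtain ⟨e, he, rfl⟩ := hp y₀
  have ht : D.proj c μ ν j z₀ ∈ e.target := h ▸ e.map_source he
  refine ⟨fun z => e.symm (D.proj c μ ν j z), ?_, ?_⟩
  · have := (e.continuousAt_symm ht).tendsto.comp ((continuous_proj j).tendsto z₀)
    rwa [← h, e.left_inv he] at this
  · filter_upwards [(continuous_proj j).continuousAt.preimage_mem_nhds
      (e.open_target.mem_nhds ht)] with z hz
    exact e.right_inv hz

variable {S : D.TwoSides}

theorem exists_isGerm (hc : ∀ i, 0 < c i) (hν : D.Admissible c μ ν) {y₀ : E}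
    (hdev : ∃ φ ∈ D.charts c μ ν, p y₀ ∈ φ.source ∧
      ∃ g : PSL(2, ℂ), ∀ᶠ y in 𝓝 y₀, dev y = g • φ (p y))
    {z₀ : D.truncated c μ ν S.j} (hz₀ : (z₀ : ℍ) ∈ S.strip c μ ν)
    (h : p y₀ = D.proj c μ ν S.j z₀) : ∃ G, IsGerm p dev y₀ z₀ G := by
  obtain ⟨φ, hφ, hs, g, hg⟩ := hdev
  obtain ⟨m, hm⟩ := TwoSides.chart_eq hc hν hφ hz₀ (h ▸ hs)
  refine ⟨g * m, ?_⟩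
  rw [IsGerm, nhds_prod_eq]
  filter_upwards [hg.prod_mk hm] with q ⟨h1, h2⟩ h3
  rw [h1, h3, h2, mul_smul]

/-- Points of a strip are interior to the truncated half-plane, so the two transformations agree on
an open set. -/
theorem psl_eq_of_eventually_truncated (hc : ∀ i, 0 < c i) (hν : D.Admissible c μ ν)
    {z₀ : D.truncated c μ ν S.j} (hz₀ : (z₀ : ℍ) ∈ S.strip c μ ν) {G G' : PSL(2, ℂ)}
    (h : ∀ᶠ z : D.truncated c μ ν S.j in 𝓝 z₀,
      G • (((z : ℍ) : ℂ) : OnePoint ℂ) = G' • (((z : ℍ) : ℂ) : OnePoint ℂ)) :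
    G = G' := by
  refine psl_eq_of_eventually (z₀ := z₀) ?_
  rw [nhds_subtype_eq_comap, Filter.eventually_comap] at h
  filter_upwards [h, (S.isOpen_strip hc).mem_nhds hz₀] with z hz hzs
  exact hz ⟨z, S.mem_truncated hν hzs⟩ rfl

theorem IsGerm.unique (hc : ∀ i, 0 < c i) (hν : D.Admissible c μ ν) (hp : IsLocalHomeomorph p)
    {y₀ : E} {z₀ : D.truncated c μ ν S.j} (hz₀ : (z₀ : ℍ) ∈ S.strip c μ ν)
    (h : p y₀ = D.proj c μ ν S.j z₀) {G G' : PSL(2, ℂ)} (hG : IsGerm p dev y₀ z₀ G)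
    (hG' : IsGerm p dev y₀ z₀ G') : G = G' := by
  obtain ⟨s, hs, hps⟩ := exists_section hp h
  refine psl_eq_of_eventually_truncated hc hν hz₀ ?_
  have ht : Filter.Tendsto (fun z => (s z, z)) (𝓝 z₀) (𝓝 (y₀, z₀)) :=
    hs.prodMk_nhds Filter.tendsto_id
  filter_upwards [ht.eventually hG, ht.eventually hG', hps] with z h1 h2 h3
  exact (h1 h3).symm.trans (h2 h3)

/-- If `dev` is equivariant under a deck transformation that translates along the core loop of an
annulus, then it transforms by a conjugate of the boundary element. -/
theorem isConj_of_translates (hc : ∀ i, 0 < c i) (hν : D.Admissible c μ ν) (hp : IsCoveringMap p)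
    (hdev : ∀ y₀, ∃ φ ∈ D.charts c μ ν, p y₀ ∈ φ.source ∧
      ∃ g : PSL(2, ℂ), ∀ᶠ y in 𝓝 y₀, dev y = g • φ (p y))
    {τ : E ≃ₜ E} (hτ : ∀ y, p (τ y) = p y) {h : PSL(2, ℂ)} (hh : ∀ y, dev (τ y) = h • dev y)
    {i : Fin D.numCurves} {x : D.Surface c μ ν} {δ : Path x x} (hδ : D.IsCoreLoop c μ ν i δ)
    (ht : Translates p τ δ) : IsConj h (dilation (c i) : PSL(2, ℂ)) := by
  obtain ⟨j, ε, ζ, hl, hζ, hζ1, hδζ⟩ := hδ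
  obtain ⟨S, rfl, rfl, rfl⟩ := exists_twoSides hl
  obtain ⟨Γ, hΓ, hΓ1⟩ := ht
  have hpζ : ∀ t, p (Γ t) = D.proj c μ ν S.j (ζ t) := fun t => (hΓ t).trans (hδζ t)
  have hs : ∀ t, (ζ t : ℍ) ∈ S.strip c μ ν := fun t =>
    hypercycle_subset_strip (hν.width_pos _) (hζ t)
  choose G hG using fun t => exists_isGerm hc hν (hdev (Γ t)) (hs t) (hpζ t)
  have hloc : IsLocallyConstant G := by
    rw [IsLocallyConstant.iff_eventually_eq]
    intro t
    have hcont : Filter.Tendsto (fun t => (Γ t, ζ t)) (𝓝 t) (𝓝 (Γ t, ζ t)) :=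
      (Γ.continuous.prodMk ζ.continuous).tendsto t
    -- A germ at `(Γ t, ζ t)` is also a germ at all nearby pairs, where uniqueness identifies it
    -- with the chosen one.
    filter_upwards [hcont.eventually (eventually_eventually_nhds.2 (hG t))] with t' ht'
    exact IsGerm.unique hc hν hp.isLocalHomeomorph (hs t') (hpζ t') (hG t') ht'
  have h01 : G 1 = G 0 := hloc.apply_eq_of_preconnectedSpace 1 0
  have key : h * G 0 = G 0 * toPSL (S.elt c) := by
    obtain ⟨s, hs1, hps⟩ := exists_section hp.isLocalHomeomorph (hpζ 0)
    refine psl_eq_of_eventually_truncated hc hν (hs 0) ?_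
    have ht0 : Filter.Tendsto (fun z => (s z, z)) (𝓝 (ζ 0)) (𝓝 (Γ 0, ζ 0)) :=
      hs1.prodMk_nhds Filter.tendsto_id
    let a : D.truncated c μ ν S.j → D.truncated c μ ν S.j :=
      fun z => ⟨S.elt c • (z : ℍ), smul_mem_truncated S.elt_mem z.2⟩
    have ha : Continuous a :=
      ((continuous_const_smul (S.elt c)).comp continuous_subtype_val).subtype_mk _
    have ha0 : a (ζ 0) = ζ 1 := Subtype.ext hζ1.symm
    have ht1 : Filter.Tendsto (fun z => (τ (s z), a z)) (𝓝 (ζ 0)) (𝓝 (Γ 1, ζ 1)) := by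
      rw [hΓ1, ← ha0]
      exact ((τ.continuous.tendsto _).comp hs1).prodMk_nhds (ha.tendsto _)
    -- The value of `dev` at `τ (s z)` is computed twice: by equivariance as `h • G 0 • z`, and by
    -- the germ at the end of the loop as `G 1 • A_ε • z`.
    filter_upwards [ht0.eventually (hG 0), ht1.eventually (hG 1), hps] with z h1 h2 h3
    have h4 := h2 (by rw [hτ, h3]; exact (proj_smul S.elt_mem rfl).symm)
    rw [mul_smul, mul_smul, ← h1 h3, ← hh, h4, h01, toPSL_smul]
  refine IsConj.trans (IsConj.symm (isConj_iff.2 ⟨G 0, ?_⟩)) (S.halfLength_eq ▸ isConj_toPSL_A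
    (ℓ := D.halfLength c S.j) (ε := S.ε) (by rw [S.halfLength_eq]; exact hc _))
  rw [← key, mul_inv_cancel_right]

end PantsDecomposition

end CGluing

end

/-! ### The holonomy of a pants curve -/

open CGluing in
theorem lemma3p1 (D : PantsDecomposition) (c : Fin D.numCurves → ℝ) (μ : Fin D.numCurves → ℂ)
    (ν : Fin D.numCurves → ℝ) (hc : ∀ i, 0 < c i)
    (hμ : ∀ i, (μ i).im ∈ Set.Ico 0 Real.pi) (hν : D.Admissible c μ ν)
    -- the surface `S`, marked by `f`, and its pants curves `curve i`
    {S : Type*} [TopologicalSpace S] (f : S ≃ₜ D.Surface c μ ν)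
    (b : Fin D.numCurves → S) (curve : ∀ i, Path (b i) (b i))
    (ha : ∀ i, ∃ (x : D.Surface c μ ν) (δ : Path x x), D.IsCoreLoop c μ ν i δ ∧
      HomotopicCurves ((curve i).map f.continuous) δ)
    -- the universal covering, a developing map and the holonomy representation
    {E : Type*} [TopologicalSpace E] [SimplyConnectedSpace E] (p : E → S) (hp : IsCoveringMap p)
    (e₀ : E) (dev : E → OnePoint ℂ)
    (ρ : (FundamentalGroup S (p e₀))ᵐᵒᵖ →* Matrix.ProjectiveSpecialLinearGroup (Fin 2) ℂ)
    (hρ : IsDevelopingPair (f.transOpenPartialHomeomorph '' D.charts c μ ν) p e₀ dev ρ)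
    -- a loop homotopic to a pants curve
    (i : Fin D.numCurves) (γ : Path (p e₀) (p e₀)) (hγ : HomotopicCurves γ (curve i)) :
    IsHyperbolic (ρ (MulOpposite.op (FundamentalGroup.fromPath (Path.Homotopic.Quotient.mk γ)))) ∧
      translationLength
        (ρ (MulOpposite.op (FundamentalGroup.fromPath (Path.Homotopic.Quotient.mk γ)))) =
          2 * c i := by
  have hloc : LocallyPathConnectedSpace E := by
    refine locallyPathConnectedSpace_of_charts hp.isLocalHomeomorph fun y => ?_
    obtain ⟨_, ⟨φ, ⟨j, hφ⟩, rfl⟩, hy, -⟩ := hρ.chart y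
    obtain ⟨z, -, hz⟩ := hφ _ hy
    exact ⟨_, hy, _, hz⟩
  obtain ⟨x, δ, hδ, hcurve⟩ := ha i
  have hq : IsCoveringMap (f ∘ p) := hp.homeomorph_comp f
  have hdev : ∀ y₀, ∃ φ ∈ D.charts c μ ν, (f ∘ p) y₀ ∈ φ.source ∧
      ∃ g : Matrix.ProjectiveSpecialLinearGroup (Fin 2) ℂ,
        ∀ᶠ y in nhds y₀, dev y = g • φ ((f ∘ p) y) := by
    intro y₀
    obtain ⟨_, ⟨φ, hφ, rfl⟩, hy, g, hg⟩ := hρ.chart y₀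
    exact ⟨φ, hφ, hy, g, hg⟩
  let Γ := hp.liftPath (γ : C(unitInterval, S)) e₀ γ.source
  have hΓ : ∀ t, p (Γ t) = γ t := congrFun (hp.liftPath_lifts (γ : C(unitInterval, S)) e₀ γ.source)
  have hΓ0 : Γ 0 = e₀ := hp.liftPath_zero (γ : C(unitInterval, S)) e₀ γ.source
  -- `τ` is the deck transformation of the class of `γ`: it takes `e₀` to the end point of the lift
  -- `Γ`.
  obtain ⟨τ, hτ, hτe⟩ := exists_deck hp (e₀ := e₀) (e₁ := Γ 1) ((hΓ 1).trans γ.target)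
  have heq := hρ.equivariant τ hτ γ ⟨Γ, hΓ0, hτe.symm⟩ hΓ
  set h := ρ (MulOpposite.op (FundamentalGroup.fromPath (Path.Homotopic.Quotient.mk γ)))
  have hqτ : ∀ y, (f ∘ p) (τ y) = (f ∘ p) y := fun y => congrArg f (hτ y)
  have hqτ' : ∀ y, (f ∘ p) (τ.symm y) = (f ∘ p) y := fun y => by
    rw [← hqτ (τ.symm y), Homeomorph.apply_symm_apply]
  have heq' : ∀ y, dev (τ.symm y) = h⁻¹ • dev y := fun y => by
    rw [eq_inv_smul_iff, ← heq, Homeomorph.apply_symm_apply]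
  have h0 : Translates (f ∘ p) τ (γ.map f.continuous) :=
    ⟨Γ, fun t => congrArg f (hΓ t), by rw [hΓ0, hτe]⟩
  -- Each of the two unoriented homotopies, from `γ` to the pants curve and from there to the core
  -- loop, may replace `τ` by its inverse.
  have h1 : Translates (f ∘ p) τ δ ∨ Translates (f ∘ p) τ.symm δ := by
    rcases h0.of_homotopicCurves hq hqτ (hγ.map f.continuous) with h1 | h1
    · exact h1.of_homotopicCurves hq hqτ hcurve
    · rcases h1.of_homotopicCurves hq hqτ' hcurve with h2 | h2
      · exact Or.inr h2
      · exact Or.inl h2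
  have hconj : IsConj h (dilation (c i) : Matrix.ProjectiveSpecialLinearGroup (Fin 2) ℂ) := by
    rcases h1 with h1 | h1
    · exact PantsDecomposition.isConj_of_translates hc hν hq hdev hqτ heq hδ h1
    · exact isConj_dilation_of_inv
        (PantsDecomposition.isConj_of_translates hc hν hq hdev hqτ' heq' hδ h1)
  exact ⟨isHyperbolic_of_isConj (hc i) hconj, translationLength_of_isConj (hc i).le hconj⟩
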